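/- Let $Y$ be a real Hilbert space with Riesz map $R\colon Y\to Y^\star$ and $U$ a real Banach space. Let $A\colon Y\times U\to Y^\star$, $\Phi\colon Y\times U\to Y$ be maps and $B\colon Y\times U\rightrightarrows Y^\star$ a set-valued map. Let $(y^*,u^*)\in Y\times U$, let $\mathcal U$ be a neighborhood of $u^*$ and let $B_r(y^*)$ (resp. $U_r(y^*)$) be the closed (resp. open) ball in $Y$ with radius $r$ and center $y^*$. "Directionally differentiable at a point" means that the one-sided difference quotients converge in norm for all directions, and $f'(x;v)=\lim_{t\searrow0}(f(x+tv)-f(x))/t$. Assume that there are constants $\varepsilon,\mu_A,L_A>0$ and $L_\Phi\in[0,1)$ such that: 1. $0\in A(y^*,u^*)+B(y^*-\Phi(y^*,u^*),u^*)$; 2. for all $u\in\mathcal U$ and $y_1,y_2\in B_\varepsilon(y^*)$: $\langle A(y_2,u)-A(y_1,u),y_2-y_1\rangle\ge\mu_A\|y_2-y_1\|^2$, $\|A(y_2,u)-A(y_1,u)\|\le L_A\|y_2-y_1\|$ and $\|\Phi(y_2,u)-\Phi(y_1,u)\|\le L_\Phi\|y_2-y_1\|$; moreover $\Phi$ is continuous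 at $(y^*,u^*)$; 3. $B(\cdot,u)$ is maximally monotone for all $u\in\mathcal U$. Its resolvent $J_B\colon Y\times\mathcal U\to Y$ is defined by letting $J_B(q,u)$ be the unique solution $y$ of $0\in R(y-q)+B(y,u)$; 4. with $\gamma_A=L_A/\mu_A$, either (a) $L_\Phi<\gamma_A^{-1}$, or (b) $L_\Phi<2\sqrt{\gamma_A}/(1+\gamma_A)$ and there is $g\colon U_\varepsilon(y^*)\times\mathcal U\to\mathbb R$ such that $A$ is the Fréchet derivative of $g$ with respect to the first variable on $U_\varepsilon(y^*)\times\mathcal U$; 5. $A$ and $\Phi$ are directionally differentiable at $(y^*,u^*)$, and $J_B$ is directionally differentiable at $(q^*-\phi^*,u^*)$, where $q^*=y^*-R^{-1}A(y^*,u^*)$ and $\phi^*=\Phi(y^*,u^*)$. Put $\xi^*=-A(y^*,u^*)$ and $$DB(y^*-\phi^*,u^*\mid\xi^*)(\delta,h)=\{R(k-\delta) : k\in Y,\ \delta=J_B'(q^*-\phi^*,u^*;k,h)\}.$$ Then there is $\tilde c\in(0,1)$ such that for all $\lambda\in(0,\varepsilon]$ and $h\in U$ there are $t_0>0$ and $C\ge0$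 for which $u^*+th\in\mathcal U$ for all $t\in[0,t_0]$ and the following hold. * For every $t\in[0,t_0]$ the equation $0\in A(y_t,u^*+th)+B(y_t-\Phi(y_t,u^*+th),u^*+th)$ has a solution $y_t\in B_\lambda(y^*)$, and this is its only solution in $B_\varepsilon(y^*)$. * For every $t\in[0,t_0]$ the iteration $y_{t,0}=y^*$, $0\in A(y_{t,n},u^*+th)+B(y_{t,n}-\Phi(y_{t,n-1},u^*+th),u^*+th)$ is well defined, in the sense that this inclusion has a unique solution $y_{t,n}\in B_\varepsilon(y^*)$ for every $n\ge1$. It satisfies $\|y_{t,n}-y_t\|\le C\,t\,\tilde c^{\,n}$ for all $n\ge0$; in particular it converges uniformly in $t\in[0,t_0]$. * For every $n\ge0$, $(y_{t,n}-y^*)/t\to\delta_n$ in $Y$ as $t\searrow0$, where $\delta_0=0$ and, for $n\ge1$, $\delta_n$ is the unique solution of $$0\in A'(y^*,u^*;\delta_n,h)+DB(y^*-\phi^*,u^*\mid\xi^*)(\delta_n-\Phi'(y^*,u^*;\delta_{n-1},h),h).$$ * The limit $\delta=\lim_{n\to\infty}\delta_n$ exists, $(y_t-y^*)/t\to\delta$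 strongly in $Y$ as $t\searrow0$, and $\delta$ is the unique solution of the linearized inclusion $$0\in A'(y^*,u^*;\delta,h)+DB(y^*-\phi^*,u^*\mid\xi^*)(\delta-\Phi'(y^*,u^*;\delta,h),h).$$ -/

import Mathlib

open Set Filter Topology

noncomputable section

namespace QGE

section DirectionalDerivative

variable {E F : Type*} [NormedAddCommGroup E] [NormedSpace ℝ E]
  [NormedAddCommGroup F] [NormedSpace ℝ F]

/-- `f` is (one-sidedly) directionally differentiable at `x`: for every direction `v` the limit
of `(f (x + t v) - f x) / t` as `t ↘ 0` exists in norm. -/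
def DirDifferentiableAt (f : E → F) (x : E) : Prop :=
  ∀ v : E, DifferentiableWithinAt ℝ (fun t : ℝ => f (x + t • v)) (Ici 0) 0

/-- The directional derivative `f'(x; v) = lim_{t ↘ 0} (f (x + t v) - f x) / t`. -/
def dirDeriv (f : E → F) (x v : E) : F :=
  derivWithin (fun t : ℝ => f (x + t • v)) (Ici 0) 0

end DirectionalDerivative

variable {Y U : Type*} [NormedAddCommGroup Y] [InnerProductSpace ℝ Y] [CompleteSpace Y]
  [NormedAddCommGroup U] [NormedSpace ℝ U]

/-- A set-valued operator `T : Y ⇉ Y⋆` is maximally monotone: it is monotone, and every point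
of `Y × Y⋆` that is monotonically related to its whole graph belongs to the graph. -/
structure IsMaximallyMonotone (T : Y → Set (StrongDual ℝ Y)) : Prop where
  monotone : ∀ y₁ y₂ : Y, ∀ ξ₁ ∈ T y₁, ∀ ξ₂ ∈ T y₂, 0 ≤ (ξ₂ - ξ₁) (y₂ - y₁)
  maximal : ∀ (y : Y) (η : StrongDual ℝ Y),
    (∀ x : Y, ∀ ξ ∈ T x, 0 ≤ (η - ξ) (y - x)) → η ∈ T y

/-- The Riesz map `R : Y → Y⋆`, `⟨R y, v⟩ = (y, v)`. -/
abbrev riesz : Y ≃ₗᵢ⋆[ℝ] StrongDual ℝ Y := InnerProductSpace.toDual ℝ Y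

/-- The resolvent `J_B : Y × U → Y` of a parametrized operator: `J_B (q, u)` is the
solution `y` of `0 ∈ R (y - q) + B (y, u)` (it exists and is unique whenever `B (·, u)` is
maximally monotone; the value is arbitrary if there is no solution). -/
def resolvent (B : Y × U → Set (StrongDual ℝ Y)) (p : Y × U) : Y :=
  Classical.epsilon fun y : Y => -riesz (y - p.1) ∈ B (y, p.2)

/-- The linearization `DB(y, u | ξ)(δ, h) = {R (k - δ) | k ∈ Y, δ = J_B'(q, u; k, h)}` with
`q = y + R⁻¹ ξ`, i.e. `y = J_B (q, u)` if `ξ ∈ B (y, u)`. -/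
def linearization (B : Y × U → Set (StrongDual ℝ Y)) (y : Y) (u : U) (ξ : StrongDual ℝ Y)
    (p : Y × U) : Set (StrongDual ℝ Y) :=
  {η | ∃ k : Y, p.1 = dirDeriv (resolvent B) (y + riesz.symm ξ, u) (k, p.2) ∧
    η = riesz (k - p.1)}

/-- `y` solves `0 ∈ A (y, u) + B (y - φ, u)`. -/
def Solves (A : Y × U → StrongDual ℝ Y) (B : Y × U → Set (StrongDual ℝ Y))
    (φ : Y) (u : U) (y : Y) : Prop :=
  -A (y, u) ∈ B (y - φ, u)

/-- `δ` solves the linearized inclusion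
`0 ∈ A'(y, u; δ, h) + DB(y - φ, u | -A(y, u))(δ - ψ, h)`. -/
def SolvesLinearized (A : Y × U → StrongDual ℝ Y) (B : Y × U → Set (StrongDual ℝ Y))
    (y : Y) (u : U) (φ : Y) (h : U) (ψ : Y) (δ : Y) : Prop :=
  -dirDeriv A (y, u) (δ, h) ∈ linearization B (y - φ) u (-A (y, u)) (δ - ψ, h)

end QGE

end

/-!
The proof solves `0 ∈ A (y, u) + B (y - φ, u)` for `y` with `φ` frozen and then iterates in `φ`.

*Dependence on `φ`.* If `y₁`, `y₂` solve the inclusion for `φ₁`, `φ₂` and `a`, `d`, `f` denote the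
increments of `A (·, u)`, `y` and `φ`, then monotonicity of `B (·, u)` gives `⟨a, d⟩ ≤ ⟨a, f⟩`.
Hence an angle condition `‖d‖ ‖a‖ ≤ κ ⟨a, d⟩` yields `‖d‖ ≤ κ ‖f‖`. With `γ = LA / μA` one can take
`κ = γ` in general and `κ = (1 + γ) / (2 √γ)` if `A (·, u)` is a gradient, because then
`A - (μA + LA) / 2 • R` is `(LA - μA) / 2`-Lipschitz
(`norm_sub_sub_smul_riesz_le_closedBall`). Both smallness conditions on `LΦ` say `κ * LΦ < 1`
(`exists_stronglyMonotoneLipschitzOn`), so the map `z ↦ y` that solves the inclusion with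
`φ = Φ (z, u)` is a contraction.

*Solvability.* Minty's theorem (`IsMaximallyMonotone.exists_neg_riesz_mem`) makes the resolvents of
`τ B (·, u)` available; the inclusion becomes a fixed point problem for a contraction near any
point of small residual (`exists_forall_exists_solution_mem_closedBall`). As `A` is only controlled
on a ball, larger changes of `φ` are reached by continuation
(`StronglyMonotoneLipschitzOn.exists_solution_of_norm_lt`). The directional derivative of the
resolvent supplies points of the graph of `B (·, u + t h)` for which the residual of `ys` is
`O(t)`. This produces the factor `t` in the convergence estimate.

*Differentiability.* The directional derivative of a resolvent is firmly nonexpansive, so the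
linearization of `B` is maximally monotone (`isMaximallyMonotone_linearization`), while `A'(·, h)`
inherits the constants of `A`. The linearized inclusion is therefore of the same type as the
original one and has a unique solution `δ` for every `ψ`. The residual of `ys + t δ` is `o(t)`,
whence `δ` is the derivative of the solutions (`tendsto_solution`). This gives the derivatives of
the iterates by induction, and the uniform estimate `‖y_{t,n} - y_t‖ ≤ C t cⁿ` allows the limits
`n → ∞` and `t ↘ 0` to be exchanged.
-/

/-! ### Minty's theorem -/

namespace QGE
section Minty
open scoped InnerProductSpace

/-- A functional `(z, s) ↦ s + ‖z‖² / 2`, bounded below on a nonempty closed convex subset of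
`H × ℝ`, attains its minimum there; the conclusion is the first-order optimality condition. -/
theorem exists_forall_sub_inner_le {H : Type*} [NormedAddCommGroup H] [InnerProductSpace ℝ H]
    [CompleteSpace H] {E : Set (H × ℝ)} (hconv : Convex ℝ E) (hclosed : IsClosed E)
    (hne : E.Nonempty) (hbdd : ∀ z ∈ E, 0 ≤ z.2 + ‖z.1‖ ^ 2 / 2) :
    ∃ z₀ ∈ E, ∀ z ∈ E, z₀.2 - ⟪z₀.1, z.1 - z₀.1⟫_ℝ ≤ z.2 := by
  set V : H × ℝ → ℝ := fun z => z.2 + ‖z.1‖ ^ 2 / 2 with hV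
  have hVc : Continuous V := by fun_prop
  set m := sInf (V '' E) with hm
  have hbelow : BddBelow (V '' E) := ⟨0, by rintro _ ⟨z, hz, rfl⟩; exact hbdd z hz⟩
  have hmle : ∀ z ∈ E, m ≤ V z := fun z hz => csInf_le hbelow ⟨z, hz, rfl⟩
  obtain ⟨v, -, hvlim, hvmem⟩ := exists_seq_tendsto_sInf (hne.image V) hbelow
  choose w hwE hwv using hvmem
  have hlim : Tendsto (fun n => V (w n)) atTop (𝓝 m) := by simpa only [hwv] using hvlim
  -- strong convexity: the midpoint of two points of `E` lies in `E`
  have hdist : ∀ a ∈ E, ∀ b ∈ E, ‖a.1 - b.1‖ ^ 2 ≤ 4 * (V a + V b - 2 * m) := by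
    intro a ha b hb
    have hmid := hmle _ (hconv ha hb (by norm_num : (0:ℝ) ≤ 1/2) (by norm_num : (0:ℝ) ≤ 1/2)
      (by norm_num))
    have hpar := parallelogram_law_with_norm ℝ a.1 b.1
    have hsc : ‖(1/2 : ℝ) • a.1 + (1/2 : ℝ) • b.1‖ = 1/2 * ‖a.1 + b.1‖ := by
      rw [← smul_add, norm_smul]; norm_num
    simp only [hV, Prod.fst_add, Prod.snd_add, Prod.smul_fst, Prod.smul_snd, smul_eq_mul,
      hsc] at hmid ⊢
    nlinarith
  have hcauchy : CauchySeq fun n => (w n).1 := by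
    rw [Metric.cauchySeq_iff]
    intro e he
    obtain ⟨N, hN⟩ := (hlim.eventually_lt_const (show m < m + e ^ 2 / 16 by
      have := pow_pos he 2; linarith)).exists_forall_of_atTop
    refine ⟨N, fun k hk l hl => ?_⟩
    have h1 := hdist _ (hwE k) _ (hwE l)
    have h2 := hN k hk
    have h3 := hN l hl
    rw [dist_eq_norm]
    refine lt_of_pow_lt_pow_left₀ 2 he.le ?_
    nlinarith [pow_pos he 2]
  obtain ⟨x, hx⟩ := cauchySeq_tendsto_of_complete hcauchy
  have hs : Tendsto (fun n => (w n).2) atTop (𝓝 (m - ‖x‖ ^ 2 / 2)) := by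
    have := hlim.sub ((hx.norm.pow 2).div_const 2)
    simpa [hV] using this
  have hmem : (x, m - ‖x‖ ^ 2 / 2) ∈ E :=
    hclosed.mem_of_tendsto (hx.prodMk_nhds hs) (Eventually.of_forall hwE)
  refine ⟨_, hmem, fun z hz => ?_⟩
  -- compare the minimum with the values at `z₀ + t (z - z₀)` and let `t ↘ 0`
  have key : ∀ t ∈ Ioc (0:ℝ) 1,
      m - ‖x‖ ^ 2 / 2 - ⟪x, z.1 - x⟫_ℝ - t * (‖z.1 - x‖ ^ 2 / 2) ≤ z.2 := by
    intro t ht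
    have h1 := hmle _ (hconv hmem hz (sub_nonneg.2 ht.2) ht.1.le (by ring))
    have hxz : (1 - t) • x + t • z.1 = x + t • (z.1 - x) := by module
    simp only [hV, Prod.fst_add, Prod.snd_add, Prod.smul_fst, Prod.smul_snd, smul_eq_mul,
      hxz, norm_add_sq_real, inner_smul_right, norm_smul, mul_pow, Real.norm_eq_abs, sq_abs] at h1
    have h2 : t * (m - ‖x‖ ^ 2 / 2 - ⟪x, z.1 - x⟫_ℝ - t * (‖z.1 - x‖ ^ 2 / 2)) ≤ t * z.2 := by
      nlinarith
    exact le_of_mul_le_mul_left h2 ht.1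
  have hcont : Tendsto (fun t : ℝ => m - ‖x‖ ^ 2 / 2 - ⟪x, z.1 - x⟫_ℝ - t * (‖z.1 - x‖ ^ 2 / 2))
      (𝓝[>] 0) (𝓝 (m - ‖x‖ ^ 2 / 2 - ⟪x, z.1 - x⟫_ℝ)) := by
    have : Continuous fun t : ℝ =>
      m - ‖x‖ ^ 2 / 2 - ⟪x, z.1 - x⟫_ℝ - t * (‖z.1 - x‖ ^ 2 / 2) := by fun_prop
    simpa using (this.tendsto 0).mono_left nhdsWithin_le_nhds
  exact le_of_tendsto hcont
    (eventually_of_mem (Ioc_mem_nhdsGT one_pos) key)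

variable {Y : Type*} [NormedAddCommGroup Y] [InnerProductSpace ℝ Y] [CompleteSpace Y]

theorem apply_eq_inner_riesz_symm (ξ : StrongDual ℝ Y) (v : Y) : ξ v = ⟪riesz.symm ξ, v⟫_ℝ :=
  (InnerProductSpace.toDual_symm_apply (𝕜 := ℝ)).symm

omit [CompleteSpace Y] in
theorem apply_le_norm_mul_norm (ξ : StrongDual ℝ Y) (v : Y) : ξ v ≤ ‖ξ‖ * ‖v‖ :=
  (le_abs_self _).trans (ξ.le_opNorm v)

omit [CompleteSpace Y] in
theorem IsMaximallyMonotone.translate {T : Y → Set (StrongDual ℝ Y)}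
    (hT : IsMaximallyMonotone T) (q : Y) : IsMaximallyMonotone fun y => T (y + q) where
  monotone y₁ y₂ ξ₁ h₁ ξ₂ h₂ := by simpa using hT.monotone _ _ ξ₁ h₁ ξ₂ h₂
  maximal y η h := hT.maximal _ _ fun x ξ hξ => by
    simpa [sub_sub_eq_add_sub] using h (x - q) ξ (by simpa using hξ)

omit [CompleteSpace Y] in
theorem IsMaximallyMonotone.smul {T : Y → Set (StrongDual ℝ Y)}
    (hT : IsMaximallyMonotone T) {τ : ℝ} (hτ : 0 < τ) :
    IsMaximallyMonotone fun y => {η | τ⁻¹ • η ∈ T y} where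
  monotone y₁ y₂ ξ₁ h₁ ξ₂ h₂ := by
    have := hT.monotone _ _ _ h₁ _ h₂
    have h3 : τ⁻¹ • ξ₂ - τ⁻¹ • ξ₁ = τ⁻¹ • (ξ₂ - ξ₁) := (smul_sub _ _ _).symm
    rw [h3, smul_apply, smul_eq_mul] at this
    exact nonneg_of_mul_nonneg_right this (inv_pos.2 hτ)
  maximal y η h := hT.maximal _ _ fun x ξ hξ => by
    have h1 := h x (τ • ξ) (by simpa [smul_smul, hτ.ne'] using hξ)
    have h2 : η - τ • ξ = τ • (τ⁻¹ • η - ξ) := by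
      rw [smul_sub, smul_inv_smul₀ hτ.ne']
    rw [h2, smul_apply, smul_eq_mul] at h1
    exact nonneg_of_mul_nonneg_right h1 hτ

/-- Minty's theorem at the origin. Minimizing the Fitzpatrick function of `T` plus half the
squared norm yields a pair `(x, p)` such that `(-p, -x)` is monotonically related to the graph
of `T`; maximality puts it into the graph, and the optimality condition forces `p = -x`. -/
theorem IsMaximallyMonotone.exists_neg_riesz_mem {T : Y → Set (StrongDual ℝ Y)}
    (hT : IsMaximallyMonotone T) : ∃ y, -riesz y ∈ T y := by
  have hmax : ∀ x p : Y, (∀ y η : Y, riesz η ∈ T y → 0 ≤ ⟪p - η, x - y⟫_ℝ) → riesz p ∈ T x := by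
    intro x p h
    refine hT.maximal _ _ fun y ξ hξ => ?_
    have := h y (riesz.symm ξ) (by simpa using hξ)
    rw [apply_eq_inner_riesz_symm]
    simpa using this
  -- the epigraph of the Fitzpatrick function
  set E : Set (WithLp 2 (Y × Y) × ℝ) :=
    {z | ∀ y η : Y, riesz η ∈ T y → ⟪y, z.1.snd⟫_ℝ + ⟪z.1.fst, η⟫_ℝ - ⟪y, η⟫_ℝ ≤ z.2} with hE
  have hFitz : ∀ z ∈ E, ⟪z.1.fst, z.1.snd⟫_ℝ ≤ z.2 := by
    intro z hz
    by_contra! hlt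
    have hmem : riesz z.1.snd ∈ T z.1.fst := by
      refine hmax _ _ fun y η hη => ?_
      have := hz y η hη
      simp only [inner_sub_left, inner_sub_right]
      rw [real_inner_comm z.1.fst z.1.snd, real_inner_comm y z.1.snd,
        real_inner_comm z.1.fst η, real_inner_comm y η]
      linarith
    have := hz _ _ hmem
    linarith
  have hconv : Convex ℝ E := by
    intro z hz w hw a b ha hb hab y η hη
    have h1 := mul_le_mul_of_nonneg_left (hz y η hη) ha
    have h2 := mul_le_mul_of_nonneg_left (hw y η hη) hb
    simp only [Prod.fst_add, Prod.snd_add, Prod.smul_fst, Prod.smul_snd, WithLp.add_fst,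
      WithLp.add_snd, WithLp.smul_fst, WithLp.smul_snd, smul_eq_mul, inner_add_left,
      inner_add_right, inner_smul_left, inner_smul_right, conj_trivial]
    have h3 : ⟪y, η⟫_ℝ = a * ⟪y, η⟫_ℝ + b * ⟪y, η⟫_ℝ := by rw [← add_mul, hab, one_mul]
    rw [h3]
    linarith
  have hclosed : IsClosed E := by
    simp only [hE, ofPred_forall]
    refine isClosed_iInter fun y => isClosed_iInter fun η => isClosed_iInter fun _ => ?_
    have h1 : Continuous fun z : WithLp 2 (Y × Y) × ℝ => z.1.fst := by fun_prop
    have h2 : Continuous fun z : WithLp 2 (Y × Y) × ℝ => z.1.snd := by fun_prop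
    exact isClosed_le (by fun_prop) (by fun_prop)
  have hgraph : ∀ x p : Y, riesz p ∈ T x → (WithLp.toLp 2 (x, p), ⟪x, p⟫_ℝ) ∈ E := by
    intro x p hxp y η hη
    have := hT.monotone _ _ _ hη _ hxp
    rw [apply_eq_inner_riesz_symm] at this
    simp only [map_sub, LinearIsometryEquiv.symm_apply_apply, inner_sub_left,
      inner_sub_right] at this
    rw [real_inner_comm x p, real_inner_comm y p, real_inner_comm x η, real_inner_comm y η] at this
    change ⟪y, p⟫_ℝ + ⟪x, η⟫_ℝ - ⟪y, η⟫_ℝ ≤ ⟪x, p⟫_ℝ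
    linarith
  have hne : E.Nonempty := by
    -- an empty graph would not be maximal
    obtain ⟨x, p, hxp⟩ : ∃ x p : Y, riesz p ∈ T x := by
      by_contra! hcon
      exact hcon 0 0 (hmax 0 0 fun y η hη => (hcon y η hη).elim)
    exact ⟨_, hgraph x p hxp⟩
  have hbdd : ∀ z ∈ E, 0 ≤ z.2 + ‖z.1‖ ^ 2 / 2 := by
    intro z hz
    have h1 := hFitz z hz
    have h2 := norm_add_sq_real z.1.fst z.1.snd
    have h3 := sq_nonneg ‖z.1.fst + z.1.snd‖
    rw [WithLp.prod_norm_sq_eq_of_L2]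
    linarith
  obtain ⟨z, hzE, hz⟩ := exists_forall_sub_inner_le hconv hclosed hne hbdd
  set x := z.1.fst with hx
  set p := z.1.snd with hp
  have hF := hFitz z hzE
  have hsq := norm_add_sq_real x p
  -- on the graph the Fitzpatrick function is the duality pairing
  have key : ∀ y η : Y, riesz η ∈ T y → ‖x + p‖ ^ 2 ≤ ⟪-x - η, -p - y⟫_ℝ := by
    intro y η hη
    have h1 := hz _ (hgraph y η hη)
    simp only [WithLp.prod_inner_apply, inner_sub_right] at h1
    change z.2 - (⟪x, y⟫_ℝ + ⟪p, η⟫_ℝ - (⟪x, x⟫_ℝ + ⟪p, p⟫_ℝ)) ≤ ⟪y, η⟫_ℝ at h1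
    simp only [inner_sub_left, inner_sub_right, inner_neg_left, inner_neg_right]
    rw [real_inner_comm p η, real_inner_comm y η]
    simp only [real_inner_self_eq_norm_sq] at h1
    linarith
  have hmem : riesz (-x) ∈ T (-p) :=
    hmax _ _ fun y η hη => (sq_nonneg _).trans (key y η hη)
  have h0 := key _ _ hmem
  simp only [sub_self, inner_zero_left] at h0
  have hxp : x + p = 0 := by
    rw [← norm_eq_zero]
    exact pow_eq_zero_iff two_ne_zero |>.1 (le_antisymm h0 (sq_nonneg _))
  refine ⟨x, ?_⟩
  rw [← map_neg, eq_neg_of_add_eq_zero_left hxp]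
  rwa [eq_neg_of_add_eq_zero_left hxp] at hmem

/-- Minty's theorem for the scaled operator `τ T`: the resolvent of `τ T` is defined
everywhere. -/
theorem IsMaximallyMonotone.exists_add_smul_eq {T : Y → Set (StrongDual ℝ Y)}
    (hT : IsMaximallyMonotone T) {τ : ℝ} (hτ : 0 < τ) (q : Y) :
    ∃ y, ∃ η ∈ T y, y + τ • riesz.symm η = q := by
  obtain ⟨y, hy⟩ := ((hT.smul hτ).translate q).exists_neg_riesz_mem
  refine ⟨y + q, _, hy, ?_⟩
  simp [smul_smul, hτ.ne']

/-- The resolvent of `τ T` is nonexpansive; it maps `y + τ R⁻¹ η` to `y` for `(y, η)` in the graph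
of `T`. -/
theorem IsMaximallyMonotone.norm_sub_le {T : Y → Set (StrongDual ℝ Y)}
    (hT : IsMaximallyMonotone T) {τ : ℝ} (hτ : 0 < τ) {y₁ y₂ : Y} {η₁ η₂ : StrongDual ℝ Y}
    (h₁ : η₁ ∈ T y₁) (h₂ : η₂ ∈ T y₂) :
    ‖y₂ - y₁‖ ≤ ‖(y₂ + τ • riesz.symm η₂) - (y₁ + τ • riesz.symm η₁)‖ := by
  have h := hT.monotone _ _ _ h₁ _ h₂
  rw [apply_eq_inner_riesz_symm, map_sub, real_inner_comm] at h
  have he : (y₂ + τ • riesz.symm η₂) - (y₁ + τ • riesz.symm η₁) =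
    (y₂ - y₁) + τ • (riesz.symm η₂ - riesz.symm η₁) := by module
  refine le_of_sq_le_sq ?_ (norm_nonneg _)
  rw [he, norm_add_sq_real, inner_smul_right]
  nlinarith [mul_nonneg hτ.le h, sq_nonneg ‖τ • (riesz.symm η₂ - riesz.symm η₁)‖]

end Minty
end QGE

/-! ### The angle condition for gradients -/

namespace QGE
section Angle
open scoped InnerProductSpace
open Metric

/-- Taylor estimate: a one-sided Lipschitz bound on the derivative bounds the remainder of the
first-order expansion from above. -/
theorem le_add_of_hasFDerivAt_of_sub_apply_le {E : Type*} [NormedAddCommGroup E] [NormedSpace ℝ E]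
    {s : Set E} (hs : Convex ℝ s) {g : E → ℝ} {a : E → StrongDual ℝ E} {L : ℝ}
    (hg : ∀ y ∈ s, HasFDerivAt g (a y) y)
    (ha : ∀ x ∈ s, ∀ y ∈ s, (a y - a x) (y - x) ≤ L * ‖y - x‖ ^ 2)
    {x y : E} (hx : x ∈ s) (hy : y ∈ s) :
    g y ≤ g x + a x (y - x) + L / 2 * ‖y - x‖ ^ 2 := by
  have hmem : ∀ t ∈ Icc (0:ℝ) 1, x + t • (y - x) ∈ s := fun t ht => by
    have := hs hx hy (sub_nonneg.2 ht.2) ht.1 (by ring)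
    convert this using 1
    module
  set ψ : ℝ → ℝ := fun t => g (x + t • (y - x)) - t * a x (y - x) - L / 2 * t ^ 2 * ‖y - x‖ ^ 2
    with hψ
  have hd : ∀ t ∈ Icc (0:ℝ) 1, HasDerivAt ψ
      (a (x + t • (y - x)) (y - x) - a x (y - x) - L * t * ‖y - x‖ ^ 2) t := by
    intro t ht
    have h1 : HasDerivAt (fun t : ℝ => x + t • (y - x)) (y - x) t := by
      simpa using ((hasDerivAt_id t).smul_const (y - x)).const_add x
    have h2 := (hg _ (hmem t ht)).comp_hasDerivAt t h1
    have h3 : HasDerivAt (fun t : ℝ => t * a x (y - x)) (a x (y - x)) t := by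
      simpa using (hasDerivAt_id t).mul_const (a x (y - x))
    have h4 : HasDerivAt (fun t : ℝ => L / 2 * t ^ 2 * ‖y - x‖ ^ 2) (L * t * ‖y - x‖ ^ 2) t := by
      refine (((hasDerivAt_pow 2 t).const_mul (L / 2)).mul_const (‖y - x‖ ^ 2)).congr_deriv ?_
      push_cast
      ring
    exact (h2.sub h3).sub h4
  have hanti : AntitoneOn ψ (Icc 0 1) := by
    refine antitoneOn_of_deriv_nonpos (convex_Icc 0 1)
      (fun t ht => (hd t ht).continuousAt.continuousWithinAt)
      (fun t ht => (hd t (interior_subset ht)).differentiableAt.differentiableWithinAt) ?_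
    intro t ht
    rw [interior_Icc] at ht
    have ht' := Ioo_subset_Icc_self ht
    rw [(hd t ht').deriv]
    have h1 := ha _ hx _ (hmem t ht')
    simp only [add_sub_cancel_left, map_smul, smul_eq_mul, sub_apply, norm_smul, mul_pow,
      Real.norm_eq_abs, sq_abs] at h1
    refine nonpos_of_mul_nonpos_right ?_ ht.1
    nlinarith
  have := hanti (left_mem_Icc.2 zero_le_one) (right_mem_Icc.2 zero_le_one) zero_le_one
  simp only [hψ, one_smul, zero_smul, add_zero] at this
  rw [add_sub_cancel] at this
  linarith

/-- A function that is Lipschitz at a fixed small scale on a convex set is Lipschitz there. -/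
theorem norm_sub_le_of_forall_norm_sub_le {E F : Type*} [NormedAddCommGroup E] [NormedSpace ℝ E]
    [NormedAddCommGroup F] {s : Set E} (hs : Convex ℝ s) {f : E → F} {K ρ : ℝ} (hρ : 0 < ρ)
    (hf : ∀ x ∈ s, ∀ y ∈ s, ‖y - x‖ ≤ ρ → ‖f y - f x‖ ≤ K * ‖y - x‖)
    {x y : E} (hx : x ∈ s) (hy : y ∈ s) : ‖f y - f x‖ ≤ K * ‖y - x‖ := by
  obtain ⟨N, hN⟩ := exists_nat_gt (‖y - x‖ / ρ)
  have hN0 : (0:ℝ) < N := lt_of_le_of_lt (by positivity) hN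
  set p : ℕ → E := fun i => x + ((i : ℝ) / N) • (y - x) with hp
  have hmem : ∀ i ≤ N, p i ∈ s := fun i hi => by
    have h1 : (i : ℝ) / N ≤ 1 := (div_le_one hN0).2 (by exact_mod_cast hi)
    have := hs hx hy (sub_nonneg.2 h1) (by positivity : (0:ℝ) ≤ (i : ℝ) / N) (by ring)
    convert this using 1
    simp only [hp]
    module
  have hstep : ∀ i, p (i + 1) - p i = (N : ℝ)⁻¹ • (y - x) := fun i => by
    simp only [hp, add_sub_add_left_eq_sub, ← sub_smul]
    congr 1
    push_cast
    field_simp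
    ring
  have key : ∀ i ≤ N, ‖f (p i) - f x‖ ≤ K * ((i : ℝ) / N * ‖y - x‖) := by
    intro i
    induction i with
    | zero => simp [hp]
    | succ i ih =>
      intro hi
      have h1 := ih (by omega)
      have hn : ‖p (i + 1) - p i‖ = (N : ℝ)⁻¹ * ‖y - x‖ := by
        rw [hstep, norm_smul, Real.norm_of_nonneg (by positivity)]
      have h2 := hf _ (hmem i (by omega)) _ (hmem (i + 1) hi) (by
        rw [hn, inv_mul_le_iff₀ hN0]
        exact ((div_lt_iff₀ hρ).1 hN).le)
      rw [hn] at h2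
      calc ‖f (p (i + 1)) - f x‖ ≤ ‖f (p (i + 1)) - f (p i)‖ + ‖f (p i) - f x‖ :=
            norm_sub_le_norm_sub_add_norm_sub _ _ _
        _ ≤ K * ((N : ℝ)⁻¹ * ‖y - x‖) + K * ((i : ℝ) / N * ‖y - x‖) := add_le_add h2 h1
        _ = _ := by push_cast; ring
  have := key N le_rfl
  rw [div_self hN0.ne', one_mul] at this
  simpa [hp, div_self hN0.ne'] using this

variable {Y : Type*} [NormedAddCommGroup Y] [InnerProductSpace ℝ Y] [CompleteSpace Y]

/-- For a gradient `a` with `μ ‖y - x‖² ≤ ⟨a y - a x, y - x⟩ ≤ L ‖y - x‖²`, the map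
`a - (μ + L) / 2 • R` is `(L - μ) / 2`-Lipschitz. This local form compares the Taylor expansions
at `x` and `y` in the two points `(x + y) / 2 ± v` with `‖v‖ = ‖y - x‖ / 2`. -/
theorem norm_sub_sub_smul_riesz_le {s : Set Y} (hs : Convex ℝ s) {g : Y → ℝ}
    {a : Y → StrongDual ℝ Y} {μ L : ℝ} (hg : ∀ y ∈ s, HasFDerivAt g (a y) y)
    (hμ : ∀ x ∈ s, ∀ y ∈ s, μ * ‖y - x‖ ^ 2 ≤ (a y - a x) (y - x))
    (hL : ∀ x ∈ s, ∀ y ∈ s, (a y - a x) (y - x) ≤ L * ‖y - x‖ ^ 2) (hμL : μ ≤ L)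
    {x y : Y} (hxy : closedBall ((1 / 2 : ℝ) • (x + y)) (‖y - x‖ / 2) ⊆ s) :
    ‖(a y - ((μ + L) / 2) • riesz y) - (a x - ((μ + L) / 2) • riesz x)‖
      ≤ (L - μ) / 2 * ‖y - x‖ := by
  set d : Y := (1 / 2 : ℝ) • (y - x) with hd
  have hnd : ‖d‖ = ‖y - x‖ / 2 := by rw [hd, norm_smul]; norm_num; ring
  have hmem : ∀ v : Y, ‖v‖ = ‖d‖ → (1 / 2 : ℝ) • (x + y) + v ∈ s := fun v hv =>
    hxy (by simp [hv, hnd])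
  have hxs : x ∈ s := by
    convert hmem (-d) (norm_neg d) using 1; rw [hd]; module
  have hys : y ∈ s := by
    convert hmem d rfl using 1; rw [hd]; module
  have hup := fun p (hp : p ∈ s) q (hq : q ∈ s) =>
    le_add_of_hasFDerivAt_of_sub_apply_le hs hg hL hp hq
  have hlow : ∀ p ∈ s, ∀ q ∈ s, g p + a p (q - p) + μ / 2 * ‖q - p‖ ^ 2 ≤ g q := by
    intro p hp q hq
    have := le_add_of_hasFDerivAt_of_sub_apply_le (g := fun z => -g z) (a := fun z => -a z)
      (L := -μ) hs (fun z hz => (hg z hz).neg) (fun u hu w hw => by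
        have := hμ u hu w hw
        have h2 : -a w - -a u = -(a w - a u) := by abel
        rw [h2, neg_apply]
        linarith) hp hq
    rw [neg_apply] at this
    linarith
  set b : Y := riesz.symm (a y - a x) - ((μ + L) / 2) • (y - x) with hb
  have hnorm : ‖(a y - ((μ + L) / 2) • riesz y) - (a x - ((μ + L) / 2) • riesz x)‖ = ‖b‖ := by
    rw [← riesz.norm_map b, hb]
    congr 1
    simp only [map_sub, LinearIsometryEquiv.apply_symm_apply, map_smulₛₗ, conj_trivial]
    module
  rw [hnorm]
  -- `v` ranges over the sphere of radius `‖d‖`; the best choice is parallel to `b`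
  have key : ∀ v : Y, ‖v‖ = ‖d‖ → ⟪b, v⟫_ℝ ≤ (L - μ) * ‖d‖ ^ 2 := by
    intro v hv
    have hp := hmem v hv
    have hm := hmem (-v) (by rw [norm_neg, hv])
    have e1 : (1 / 2 : ℝ) • (x + y) + v - x = d + v := by rw [hd]; module
    have e2 : (1 / 2 : ℝ) • (x + y) + v - y = -(d - v) := by rw [hd]; module
    have e3 : (1 / 2 : ℝ) • (x + y) + -v - x = d - v := by rw [hd]; module
    have e4 : (1 / 2 : ℝ) • (x + y) + -v - y = -(d + v) := by rw [hd]; module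
    have h1 := hup x hxs _ hp
    have h2 := hlow y hys _ hp
    have h3 := hup y hys _ hm
    have h4 := hlow x hxs _ hm
    rw [e1] at h1
    rw [e2] at h2
    rw [e3] at h4
    rw [e4] at h3
    have hyx : y - x = (2 : ℝ) • d := by rw [hd]; module
    have hbv : ⟪b, v⟫_ℝ = a y v - a x v - (μ + L) * ⟪d, v⟫_ℝ := by
      rw [hb, inner_sub_left, ← apply_eq_inner_riesz_symm, sub_apply, hyx, smul_smul,
        real_inner_smul_left]
      ring
    simp only [norm_neg, map_neg, map_add, map_sub, norm_add_sq_real, norm_sub_sq_real, hv]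
      at h1 h2 h3 h4
    rw [hbv]
    nlinarith
  rcases eq_or_ne b 0 with h0 | h0
  · rw [h0, norm_zero]
    exact mul_nonneg (by linarith) (norm_nonneg _)
  have hb0 : 0 < ‖b‖ := norm_pos_iff.2 h0
  have h1 := key ((‖d‖ / ‖b‖) • b) (by
    rw [norm_smul, Real.norm_of_nonneg (by positivity), div_mul_cancel₀ _ hb0.ne'])
  rw [real_inner_smul_right, real_inner_self_eq_norm_sq] at h1
  have h2 : ‖d‖ / ‖b‖ * ‖b‖ ^ 2 = ‖d‖ * ‖b‖ := by field_simp
  rw [h2] at h1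
  rcases (norm_nonneg d).eq_or_lt with hd0 | hd0
  · have h3 : y - x = 0 := by rw [← norm_eq_zero]; linarith
    have : b = 0 := by rw [hb, sub_eq_zero.1 h3]; simp
    exact absurd this h0
  · have h3 : ‖b‖ ≤ (L - μ) * ‖d‖ := by
      refine le_of_mul_le_mul_left ?_ hd0
      linarith
    rw [hnd] at h3
    linarith

/-- On a closed ball of radius `ε` the Lipschitz estimate for `a - (μ + L) / 2 • R` only needs
`a` to be a gradient on the open ball. -/
theorem norm_sub_sub_smul_riesz_le_closedBall {c : Y} {ε : ℝ} (hε : 0 < ε) {g : Y → ℝ}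
    {a : Y → StrongDual ℝ Y} {μ L : ℝ} (hg : ∀ y ∈ ball c ε, HasFDerivAt g (a y) y)
    (hμ : ∀ x ∈ closedBall c ε, ∀ y ∈ closedBall c ε, μ * ‖y - x‖ ^ 2 ≤ (a y - a x) (y - x))
    (hL : ∀ x ∈ closedBall c ε, ∀ y ∈ closedBall c ε, ‖a y - a x‖ ≤ L * ‖y - x‖) (hμL : μ ≤ L)
    (hL0 : 0 ≤ L) {x y : Y} (hx : x ∈ closedBall c ε) (hy : y ∈ closedBall c ε) :
    ‖(a y - ((μ + L) / 2) • riesz y) - (a x - ((μ + L) / 2) • riesz x)‖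
      ≤ (L - μ) / 2 * ‖y - x‖ := by
  set f : Y → StrongDual ℝ Y := fun y => a y - ((μ + L) / 2) • riesz y with hf
  have hsub : ball c ε ⊆ closedBall c ε := ball_subset_closedBall
  have hopen : ∀ x ∈ ball c ε, ∀ y ∈ ball c ε, ‖f y - f x‖ ≤ (L - μ) / 2 * ‖y - x‖ := by
    intro x hx y hy
    set r := max (dist x c) (dist y c) with hr
    have hrε : r < ε := max_lt hx hy
    refine norm_sub_le_of_forall_norm_sub_le (convex_closedBall c r) (sub_pos.2 hrε) ?_
      (mem_closedBall.2 (le_max_left _ _)) (mem_closedBall.2 (le_max_right _ _))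
    intro p hp q hq hpq
    refine norm_sub_sub_smul_riesz_le (convex_ball c ε) hg
      (fun x hx y hy => hμ x (hsub hx) y (hsub hy))
      (fun x hx y hy => ?_) hμL ?_
    · calc (a y - a x) (y - x) ≤ ‖a y - a x‖ * ‖y - x‖ := apply_le_norm_mul_norm _ _
        _ ≤ L * ‖y - x‖ * ‖y - x‖ := by gcongr; exact hL x (hsub hx) y (hsub hy)
        _ = _ := by ring
    · have hmid : (1 / 2 : ℝ) • (p + q) ∈ closedBall c r := by
        rw [smul_add]
        exact convex_closedBall c r hp hq (by norm_num) (by norm_num) (by norm_num)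
      refine closedBall_subset_ball' ?_
      rw [mem_closedBall] at hmid
      linarith
  have hac : ContinuousOn f (closedBall c ε) := by
    have h1 : LipschitzOnWith ⟨L, hL0⟩ a (closedBall c ε) :=
      LipschitzOnWith.of_dist_le_mul fun x hx y hy => by
        rw [dist_eq_norm, dist_eq_norm]
        exact hL y hy x hx
    have h2 : Continuous fun y : Y => ((μ + L) / 2) • riesz y := by fun_prop
    exact h1.continuousOn.sub h2.continuousOn
  have hlip : LipschitzOnWith ⟨(L - μ) / 2, by linarith⟩ f (ball c ε) :=
    LipschitzOnWith.of_dist_le_mul fun x hx y hy => by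
      rw [dist_eq_norm, dist_eq_norm]
      exact hopen y hy x hx
  have := (hlip.closure (by rwa [closure_ball c hε.ne'])).dist_le_mul y
    (by rwa [closure_ball c hε.ne']) x (by rwa [closure_ball c hε.ne'])
  rw [dist_eq_norm, dist_eq_norm] at this
  exact this

/-- The cosine of the angle between `d` and a vector of the ball of center `(μ + L) / 2 • d` and
radius `(L - μ) / 2 * ‖d‖` is at least `2 √γ / (1 + γ)`, where `γ = L / μ`. -/
theorem norm_mul_norm_le_of_norm_sub_smul_le {μ L : ℝ} (hμ : 0 < μ) (hL : 0 < L) {d : Y}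
    {a : StrongDual ℝ Y}
    (h : ‖a - ((μ + L) / 2) • riesz d‖ ≤ (L - μ) / 2 * ‖d‖) :
    ‖d‖ * ‖a‖ ≤ (1 + L / μ) / (2 * √(L / μ)) * a d := by
  set s := √(L / μ) with hs
  have hs0 : 0 < s := Real.sqrt_pos.2 (div_pos hL hμ)
  have hs2 : s ^ 2 = L / μ := Real.sq_sqrt (div_pos hL hμ).le
  have hLs : L = μ * s ^ 2 := by rw [hs2]; field_simp
  set b := riesz.symm a with hb
  have hn : ‖a‖ = ‖b‖ := (riesz.symm.norm_map a).symm
  have h1 : ‖b - ((μ + L) / 2) • d‖ ≤ (L - μ) / 2 * ‖d‖ := by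
    rw [← riesz.norm_map]
    simpa [hb, map_smulₛₗ] using h
  have h2 := pow_le_pow_left₀ (norm_nonneg _) h1 2
  rw [norm_sub_sq_real, norm_smul, real_inner_smul_right, mul_pow, Real.norm_eq_abs, sq_abs] at h2
  rw [apply_eq_inner_riesz_symm, hn, ← hs2, div_mul_eq_mul_div, le_div_iff₀ (by positivity)]
  rw [hLs] at h2
  refine le_of_mul_le_mul_left ?_ hμ
  nlinarith [sq_nonneg (‖b‖ - μ * s * ‖d‖)]

end Angle
end QGE

/-! ### Strongly monotone perturbations of maximally monotone operators -/

namespace QGE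
section Solvability
open scoped InnerProductSpace
open Metric

/-- The contraction principle on a closed subset of a complete metric space. -/
theorem exists_isFixedPt_of_dist_le {X : Type*} [MetricSpace X] [CompleteSpace X] {s : Set X}
    (hs : IsClosed s) (hne : s.Nonempty) {f : X → X} (hf : MapsTo f s s) {q : ℝ} (hq0 : 0 ≤ q)
    (hq : q < 1) (hdist : ∀ x ∈ s, ∀ y ∈ s, dist (f x) (f y) ≤ q * dist x y) :
    ∃ x ∈ s, f x = x := by
  obtain ⟨x, hx⟩ := hne
  have hc : ContractingWith ⟨q, hq0⟩ (hf.restrict f s s) :=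
    ⟨by exact_mod_cast hq, LipschitzWith.of_dist_le_mul fun x y => hdist x x.2 y y.2⟩
  obtain ⟨y, hy, hfy, -⟩ := hc.exists_fixedPoint' hs.isComplete hf hx (edist_ne_top _ _)
  exact ⟨y, hy, hfy⟩

variable {Y : Type*} [NormedAddCommGroup Y] [InnerProductSpace ℝ Y] [CompleteSpace Y]

/-- `a : Y → Y⋆` is `μ`-strongly monotone and `L`-Lipschitz on `s`, and the cosine of the angle
between its increments and those of the argument is at least `κ⁻¹`. The last property is what
controls the dependence of the solutions of `0 ∈ a y + T (y - φ)` on `φ`. -/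
structure StronglyMonotoneLipschitzOn (a : Y → StrongDual ℝ Y) (s : Set Y) (μ L κ : ℝ) :
    Prop where
  mono : ∀ y₁ ∈ s, ∀ y₂ ∈ s, μ * ‖y₂ - y₁‖ ^ 2 ≤ (a y₂ - a y₁) (y₂ - y₁)
  lip : ∀ y₁ ∈ s, ∀ y₂ ∈ s, ‖a y₂ - a y₁‖ ≤ L * ‖y₂ - y₁‖
  angle : ∀ y₁ ∈ s, ∀ y₂ ∈ s, ‖y₂ - y₁‖ * ‖a y₂ - a y₁‖ ≤ κ * (a y₂ - a y₁) (y₂ - y₁)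

variable {T : Y → Set (StrongDual ℝ Y)} {a : Y → StrongDual ℝ Y} {s : Set Y} {μ L κ : ℝ}

omit [CompleteSpace Y] in
/-- The solutions of `0 ∈ a y + T (y - φ)` depend on `φ` in a `κ`-Lipschitz way. -/
theorem StronglyMonotoneLipschitzOn.norm_solution_sub_le
    (ha : StronglyMonotoneLipschitzOn a s μ L κ) (hT : IsMaximallyMonotone T) (hμ : 0 < μ)
    (hκ : 0 ≤ κ) {y₁ y₂ φ₁ φ₂ : Y} (h₁ : y₁ ∈ s) (h₂ : y₂ ∈ s) (hs₁ : -a y₁ ∈ T (y₁ - φ₁))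
    (hs₂ : -a y₂ ∈ T (y₂ - φ₂)) : ‖y₂ - y₁‖ ≤ κ * ‖φ₂ - φ₁‖ := by
  have h := hT.monotone _ _ _ hs₁ _ hs₂
  have e1 : -a y₂ - -a y₁ = -(a y₂ - a y₁) := by abel
  have e2 : y₂ - φ₂ - (y₁ - φ₁) = (y₂ - y₁) - (φ₂ - φ₁) := by abel
  rw [e1, e2, neg_apply, map_sub] at h
  have h1 := ha.angle _ h₁ _ h₂
  have h2 := ha.mono _ h₁ _ h₂
  have h3 : (a y₂ - a y₁) (φ₂ - φ₁) ≤ ‖a y₂ - a y₁‖ * ‖φ₂ - φ₁‖ :=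
    apply_le_norm_mul_norm _ _
  rcases (norm_nonneg (a y₂ - a y₁)).eq_or_lt with h0 | h0
  · have h4 : ‖y₂ - y₁‖ ^ 2 ≤ 0 := by
      rw [norm_eq_zero.1 h0.symm, zero_apply] at h2
      exact nonpos_of_mul_nonpos_right h2 hμ
    rw [pow_eq_zero_iff two_ne_zero |>.1 (le_antisymm h4 (sq_nonneg _))]
    positivity
  · refine le_of_mul_le_mul_left ?_ h0
    nlinarith [mul_le_mul_of_nonneg_left h3 hκ]

omit [CompleteSpace Y] in
/-- A posteriori estimate: the distance of a solution `y` of `0 ∈ a y + T (y - φ)` to an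
arbitrary point `z` is bounded by the residual of `z`, computed with any point `(w, η)` of the
graph of `T`. -/
theorem StronglyMonotoneLipschitzOn.norm_sub_le_residual
    (ha : StronglyMonotoneLipschitzOn a s μ L κ) (hT : IsMaximallyMonotone T) (hμ : 0 < μ)
    (hL : 0 ≤ L) {y z φ w : Y} {η : StrongDual ℝ Y} (hy : y ∈ s) (hz : z ∈ s)
    (hsol : -a y ∈ T (y - φ)) (hη : η ∈ T w) :
    ‖y - z‖ ≤ ((L + 2) / μ + 1) * (‖φ + w - z‖ + ‖η + a z‖) := by
  have h := hT.monotone _ _ _ hη _ hsol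
  have e1 : -a y - η = -((a y - a z) + (η + a z)) := by abel
  have e2 : y - φ - w = (y - z) - (φ + w - z) := by abel
  rw [e1, e2, neg_apply, add_apply, map_sub _ (y - z),
    map_sub _ (y - z)] at h
  have h1 := ha.mono _ hz _ hy
  have h2 := ha.lip _ hz _ hy
  set D := ‖y - z‖
  set e := ‖φ + w - z‖
  set ρ := ‖η + a z‖
  have hD : 0 ≤ D := norm_nonneg _
  have he : 0 ≤ e := norm_nonneg _
  have hρ : 0 ≤ ρ := norm_nonneg _
  have h3 : (a y - a z) (φ + w - z) ≤ L * D * e :=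
    (apply_le_norm_mul_norm _ _).trans (by gcongr)
  have h4 : -(η + a z) (y - z) ≤ ρ * D :=
    (neg_le_abs _).trans ((η + a z).le_opNorm _)
  have h5 : (η + a z) (φ + w - z) ≤ ρ * e := apply_le_norm_mul_norm _ _
  have hmain : μ * D ^ 2 ≤ L * D * e + ρ * D + ρ * e := by linarith
  rcases le_total D (e + ρ) with hle | hle
  · have : 0 ≤ (L + 2) / μ * (e + ρ) := by positivity
    linarith
  · have h6 : μ * D ^ 2 ≤ (L + 2) * (e + ρ) * D := by
      nlinarith [mul_nonneg (mul_nonneg hL hD) hρ, mul_nonneg he hD,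
        mul_le_mul_of_nonneg_left hle hρ, mul_nonneg hρ hρ]
    have h7 : D ≤ (L + 2) / μ * (e + ρ) := by
      rcases hD.eq_or_lt with h0 | h0
      · rw [← h0]; positivity
      · rw [div_mul_eq_mul_div, le_div_iff₀ hμ]
        refine le_of_mul_le_mul_right ?_ h0
        linarith
    linarith

/-- Local solvability: if the residual of `z` is at most `θ r`, where `θ` only depends on `μ` and
`L`, then `0 ∈ a y + T (y - φ)` has a solution in the closed ball of center `z` and radius `r`.
It is a fixed point of the contraction `y ↦ φ + J_τ (y - φ - τ R⁻¹ (a y))`, where `J_τ` is the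
resolvent of `τ T` and `τ = μ / L²`. -/
theorem exists_forall_exists_solution_mem_closedBall (hμ : 0 < μ) (hμL : μ ≤ L) :
    ∃ θ > (0 : ℝ), ∀ {T : Y → Set (StrongDual ℝ Y)} {a : Y → StrongDual ℝ Y} {s : Set Y} {κ : ℝ},
      IsMaximallyMonotone T → StronglyMonotoneLipschitzOn a s μ L κ →
      ∀ {φ z w : Y} {η : StrongDual ℝ Y} {r : ℝ}, 0 ≤ r → closedBall z r ⊆ s → η ∈ T w →
        ‖φ + w - z‖ + ‖η + a z‖ ≤ θ * r → ∃ y ∈ closedBall z r, -a y ∈ T (y - φ) := by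
  have hL : 0 < L := hμ.trans_le hμL
  set τ := μ / L ^ 2 with hτdef
  have hτ : 0 < τ := by positivity
  set q := √(1 - (μ / L) ^ 2) with hq
  have hq0 : 0 ≤ q := Real.sqrt_nonneg _
  have hμL1 : (μ / L) ^ 2 ≤ 1 := pow_le_one₀ (by positivity) ((div_le_one hL).2 hμL)
  have hq2 : q ^ 2 = 1 - (μ / L) ^ 2 := Real.sq_sqrt (by linarith)
  have hq1 : q < 1 := by
    have : 0 < (μ / L) ^ 2 := by positivity
    nlinarith
  refine ⟨(1 - q) / (2 + τ), div_pos (by linarith) (by linarith), ?_⟩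
  intro T a s κ hT ha φ z w η r hr hball hη hres
  choose J N hN hJ using fun x => hT.exists_add_smul_eq hτ x
  set F : Y → Y := fun y => φ + J (y - φ - τ • riesz.symm (a y)) with hF
  have hcontr : ∀ x ∈ closedBall z r, ∀ y ∈ closedBall z r, dist (F x) (F y) ≤ q * dist x y := by
    intro x hx y hy
    rw [dist_comm, dist_comm x y, dist_eq_norm, dist_eq_norm]
    have h1 := hT.norm_sub_le hτ (hN (x - φ - τ • riesz.symm (a x)))
      (hN (y - φ - τ • riesz.symm (a y)))
    rw [hJ, hJ] at h1
    have e1 : F y - F x = J (y - φ - τ • riesz.symm (a y)) - J (x - φ - τ • riesz.symm (a x)) := by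
      simp only [hF]; abel
    have e2 : y - φ - τ • riesz.symm (a y) - (x - φ - τ • riesz.symm (a x)) =
        (y - x) - τ • riesz.symm (a y - a x) := by rw [map_sub]; module
    rw [e1]
    refine h1.trans (le_of_sq_le_sq ?_ (by positivity))
    have h2 := ha.mono _ (hball hx) _ (hball hy)
    have h3 := pow_le_pow_left₀ (norm_nonneg _) (ha.lip _ (hball hx) _ (hball hy)) 2
    rw [apply_eq_inner_riesz_symm, real_inner_comm] at h2
    rw [e2, norm_sub_sq_real, norm_smul, mul_pow, real_inner_smul_right,
      LinearIsometryEquiv.norm_map, Real.norm_eq_abs, sq_abs, mul_pow, hq2]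
    have h4 : τ * μ = (μ / L) ^ 2 := by rw [hτdef]; field_simp
    have h5 : τ ^ 2 * L ^ 2 = (μ / L) ^ 2 := by rw [hτdef]; field_simp
    calc _ ≤ ‖y - x‖ ^ 2 - 2 * (τ * (μ * ‖y - x‖ ^ 2)) + τ ^ 2 * (L * ‖y - x‖) ^ 2 := by gcongr
      _ = ‖y - x‖ ^ 2 - 2 * (τ * μ) * ‖y - x‖ ^ 2 + (τ ^ 2 * L ^ 2) * ‖y - x‖ ^ 2 := by ring
      _ = _ := by rw [h4, h5]; ring
  have hz : z ∈ closedBall z r := mem_closedBall_self hr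
  have hFz : ‖F z - z‖ ≤ (1 - q) * r := by
    have h1 := hT.norm_sub_le hτ hη (hN (z - φ - τ • riesz.symm (a z)))
    rw [hJ] at h1
    have e2 : z - φ - τ • riesz.symm (a z) - (w + τ • riesz.symm η) =
        -(φ + w - z) - τ • riesz.symm (η + a z) := by rw [map_add]; module
    have h2 := norm_sub_le (-(φ + w - z)) (τ • riesz.symm (η + a z))
    rw [norm_neg, norm_smul, LinearIsometryEquiv.norm_map, Real.norm_of_nonneg hτ.le] at h2
    have e3 : F z - z = (φ + w - z) + (J (z - φ - τ • riesz.symm (a z)) - w) := by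
      simp only [hF]; abel
    have h3 := norm_add_le (φ + w - z) (J (z - φ - τ • riesz.symm (a z)) - w)
    rw [e2] at h1
    rw [div_mul_eq_mul_div, le_div_iff₀ (by linarith)] at hres
    rw [e3]
    have := norm_nonneg (φ + w - z)
    have := norm_nonneg (η + a z)
    nlinarith
  have hmaps : MapsTo F (closedBall z r) (closedBall z r) := by
    intro y hy
    have h1 := hcontr y hy z hz
    have h2 := dist_triangle (F y) (F z) z
    rw [dist_eq_norm (F z)] at h2
    rw [mem_closedBall] at hy ⊢
    nlinarith [mul_le_mul_of_nonneg_left hy hq0]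
  obtain ⟨y, hy, hfix⟩ := exists_isFixedPt_of_dist_le isClosed_closedBall ⟨z, hz⟩ hmaps hq0 hq1
    hcontr
  refine ⟨y, hy, ?_⟩
  have h1 := hN (y - φ - τ • riesz.symm (a y))
  have h2 := hJ (y - φ - τ • riesz.symm (a y))
  have h3 : J (y - φ - τ • riesz.symm (a y)) = y - φ := eq_sub_of_add_eq' hfix
  rw [h3] at h1 h2
  have h4 : riesz.symm (N (y - φ - τ • riesz.symm (a y))) = riesz.symm (-a y) := by
    refine smul_right_injective Y hτ.ne' ?_
    simp only [map_neg, smul_neg]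
    exact add_left_cancel (h2.trans (sub_eq_add_neg _ _))
  rwa [riesz.symm.injective h4] at h1

/-- Continuation in `φ`: from a solution `y₀` for `φ₀` one reaches a solution for `φ` in finitely
many steps of equal length as long as the `κ`-Lipschitz estimate keeps all intermediate solutions
in the interior of the ball. -/
theorem StronglyMonotoneLipschitzOn.exists_solution_of_norm_lt {c : Y} {ε : ℝ}
    (ha : StronglyMonotoneLipschitzOn a (closedBall c ε) μ L κ) (hT : IsMaximallyMonotone T)
    (hμ : 0 < μ) (hμL : μ ≤ L) (hκ : 0 ≤ κ) {y₀ φ₀ φ : Y} (hs₀ : -a y₀ ∈ T (y₀ - φ₀))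
    (hlt : ‖y₀ - c‖ + κ * ‖φ - φ₀‖ < ε) :
    ∃ y ∈ closedBall c ε, -a y ∈ T (y - φ) := by
  obtain ⟨θ, hθ, hex⟩ := exists_forall_exists_solution_mem_closedBall (Y := Y) hμ hμL
  have hy₀ : y₀ ∈ closedBall c ε := by
    rw [mem_closedBall, dist_eq_norm]
    have : 0 ≤ κ * ‖φ - φ₀‖ := by positivity
    linarith
  set r := ε - (‖y₀ - c‖ + κ * ‖φ - φ₀‖) with hr
  have hr0 : 0 < r := sub_pos.2 hlt
  obtain ⟨N, hN⟩ := exists_nat_gt (‖φ - φ₀‖ / (θ * r))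
  have hN0 : (0:ℝ) < N := lt_of_le_of_lt (by positivity) hN
  set p : ℕ → Y := fun i => φ₀ + ((i : ℝ) / N) • (φ - φ₀) with hp
  have hstep : ∀ i, p (i + 1) - p i = (N : ℝ)⁻¹ • (φ - φ₀) := fun i => by
    simp only [hp, add_sub_add_left_eq_sub, ← sub_smul]
    congr 1
    push_cast
    field_simp
    ring
  have key : ∀ i ≤ N, ∃ y ∈ closedBall c ε, -a y ∈ T (y - p i) := by
    intro i
    induction i with
    | zero => intro _; exact ⟨y₀, hy₀, by simpa [hp] using hs₀⟩
    | succ i ih =>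
      intro hi
      obtain ⟨y, hy, hsol⟩ := ih (by omega)
      have h1 := ha.norm_solution_sub_le hT hμ hκ hy₀ hy hs₀ hsol
      have h2 : ‖p i - φ₀‖ ≤ ‖φ - φ₀‖ := by
        have : (i : ℝ) / N ≤ 1 := (div_le_one hN0).2 (by exact_mod_cast (by omega : i ≤ N))
        simp only [hp, add_sub_cancel_left, norm_smul]
        rw [Real.norm_of_nonneg (by positivity)]
        exact mul_le_of_le_one_left (norm_nonneg _) this
      have hball : closedBall y r ⊆ closedBall c ε := by
        refine closedBall_subset_closedBall' ?_
        have h3 := dist_triangle y y₀ c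
        rw [dist_eq_norm y y₀, dist_eq_norm y₀ c] at h3
        have h4 := mul_le_mul_of_nonneg_left h2 hκ
        linarith
      obtain ⟨y', hy', hsol'⟩ := hex hT ha (φ := p (i + 1)) hr0.le hball hsol (by
        have e : p (i + 1) + (y - p i) - y = p (i + 1) - p i := by abel
        rw [e, hstep, neg_add_cancel, norm_zero, add_zero, norm_smul,
          Real.norm_of_nonneg (by positivity), inv_mul_le_iff₀ hN0]
        exact ((div_lt_iff₀ (by positivity)).1 hN).le)
      exact ⟨y', hball hy', hsol'⟩
  have := key N le_rfl
  simpa [hp, div_self hN0.ne'] using this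

/-- Global solvability. -/
theorem StronglyMonotoneLipschitzOn.exists_solution (ha : StronglyMonotoneLipschitzOn a univ μ L κ)
    (hT : IsMaximallyMonotone T) (hμ : 0 < μ) (hμL : μ ≤ L) (φ : Y) :
    ∃ y, -a y ∈ T (y - φ) := by
  obtain ⟨θ, hθ, hex⟩ := exists_forall_exists_solution_mem_closedBall (Y := Y) hμ hμL
  obtain ⟨w, η, hη, -⟩ := hT.exists_add_smul_eq one_pos 0
  obtain ⟨y, -, hy⟩ := hex hT ha (φ := φ) (z := 0)
    (r := (‖φ + w - 0‖ + ‖η + a 0‖) / θ) (by positivity) (subset_univ _) hη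
    (by rw [mul_div_cancel₀ _ hθ.ne'])
  exact ⟨y, hy⟩

end Solvability
end QGE

/-! ### Directional derivatives and the linearization -/

namespace QGE
section Linearization
open scoped InnerProductSpace
open Metric

section

variable {E F : Type*} [NormedAddCommGroup E] [NormedSpace ℝ E]
  [NormedAddCommGroup F] [NormedSpace ℝ F]

theorem DirDifferentiableAt.hasDerivWithinAt {f : E → F} {x : E} (hf : DirDifferentiableAt f x)
    (v : E) : HasDerivWithinAt (fun t : ℝ => f (x + t • v)) (dirDeriv f x v) (Ici 0) 0 :=
  (hf v).hasDerivWithinAt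

theorem DirDifferentiableAt.tendsto {f : E → F} {x : E} (hf : DirDifferentiableAt f x) (v : E) :
    Tendsto (fun t : ℝ => t⁻¹ • (f (x + t • v) - f x)) (𝓝[>] 0) (𝓝 (dirDeriv f x v)) := by
  have h := (hf.hasDerivWithinAt v).Ioi_of_Ici
  rw [hasDerivWithinAt_iff_tendsto_slope' (by simp)] at h
  simpa [slope_fun_def] using h

/-- On a right neighbourhood of `0`, including `0` itself, the increment along a ray is bounded
by a multiple of the step. -/
theorem DirDifferentiableAt.exists_eventually_norm_sub_le {f : E → F} {x : E}
    (hf : DirDifferentiableAt f x) (v : E) :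
    ∃ C ≥ (0 : ℝ), ∀ᶠ t : ℝ in 𝓝[≥] 0, ‖f (x + t • v) - f x‖ ≤ C * t := by
  obtain ⟨C, hC, h⟩ := (hf v).isBigO_sub.exists_nonneg
  refine ⟨C, hC, ?_⟩
  filter_upwards [h.bound, self_mem_nhdsWithin] with t ht ht0
  simpa [abs_of_nonneg (show (0:ℝ) ≤ t from ht0)] using ht

end

variable {Y U : Type*} [NormedAddCommGroup Y] [InnerProductSpace ℝ Y] [CompleteSpace Y]
  [NormedAddCommGroup U] [NormedSpace ℝ U]

omit [NormedAddCommGroup U] [NormedSpace ℝ U] in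
theorem neg_riesz_resolvent_sub_mem {B : Y × U → Set (StrongDual ℝ Y)} {u : U}
    (hB : IsMaximallyMonotone fun y => B (y, u)) (q : Y) :
    -riesz (resolvent B (q, u) - q) ∈ B (resolvent B (q, u), u) := by
  refine Classical.epsilon_spec (p := fun y : Y => -riesz (y - q) ∈ B (y, u)) ?_
  obtain ⟨y, η, hη, hy⟩ := hB.exists_add_smul_eq one_pos q
  refine ⟨y, ?_⟩
  rw [← hy]
  simpa using hη

omit [NormedAddCommGroup U] [NormedSpace ℝ U] in
theorem resolvent_add_riesz_symm {B : Y × U → Set (StrongDual ℝ Y)} {u : U}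
    (hB : IsMaximallyMonotone fun y => B (y, u)) {y : Y} {η : StrongDual ℝ Y} (hη : η ∈ B (y, u)) :
    resolvent B (y + riesz.symm η, u) = y := by
  have h := hB.norm_sub_le one_pos hη (neg_riesz_resolvent_sub_mem hB (y + riesz.symm η))
  rw [← sub_eq_zero, ← norm_le_zero_iff]
  simpa using h

omit [NormedAddCommGroup U] [NormedSpace ℝ U] in
/-- Resolvents are firmly nonexpansive. -/
theorem inner_resolvent_sub_nonneg {B : Y × U → Set (StrongDual ℝ Y)} {u : U}
    (hB : IsMaximallyMonotone fun y => B (y, u)) (q₁ q₂ : Y) :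
    0 ≤ ⟪(q₂ - q₁) - (resolvent B (q₂, u) - resolvent B (q₁, u)),
      resolvent B (q₂, u) - resolvent B (q₁, u)⟫_ℝ := by
  have h := hB.monotone _ _ _ (neg_riesz_resolvent_sub_mem hB q₁) _
    (neg_riesz_resolvent_sub_mem hB q₂)
  rw [apply_eq_inner_riesz_symm] at h
  convert h using 2
  simp only [map_sub, map_neg, LinearIsometryEquiv.symm_apply_apply]
  abel

/-- The linearization of a parametrized maximally monotone operator is maximally monotone, because
its resolvent is the directional derivative of a firmly nonexpansive map. -/
theorem isMaximallyMonotone_linearization {B : Y × U → Set (StrongDual ℝ Y)} {y : Y} {u h : U}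
    {ξ : StrongDual ℝ Y} (hJ : DirDifferentiableAt (resolvent B) (y + riesz.symm ξ, u))
    (hB : ∀ᶠ t : ℝ in 𝓝[>] 0, IsMaximallyMonotone fun z => B (z, u + t • h)) :
    IsMaximallyMonotone fun δ => linearization B y u ξ (δ, h) := by
  set q := y + riesz.symm ξ with hq
  set G : Y → Y := fun k => dirDeriv (resolvent B) (q, u) (k, h) with hG
  have hfirm : ∀ k₁ k₂ : Y, 0 ≤ ⟪(k₂ - k₁) - (G k₂ - G k₁), G k₂ - G k₁⟫_ℝ := by
    intro k₁ k₂
    have hlim := (hJ.tendsto (k₂, h)).sub (hJ.tendsto (k₁, h))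
    refine ge_of_tendsto ((tendsto_const_nhds (x := k₂ - k₁).sub hlim).inner hlim) ?_
    filter_upwards [hB, self_mem_nhdsWithin] with t hBt ht
    have ht0 : (0:ℝ) < t := ht
    have h1 := inner_resolvent_sub_nonneg hBt (q + t • k₁) (q + t • k₂)
    simp only [Prod.smul_mk, Prod.mk_add_mk]
    have e1 : t⁻¹ • (resolvent B (q + t • k₂, u + t • h) - resolvent B (q, u)) -
        t⁻¹ • (resolvent B (q + t • k₁, u + t • h) - resolvent B (q, u)) =
        t⁻¹ • (resolvent B (q + t • k₂, u + t • h) - resolvent B (q + t • k₁, u + t • h)) := by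
      module
    have e2 : k₂ - k₁ = t⁻¹ • (q + t • k₂ - (q + t • k₁)) := by
      rw [add_sub_add_left_eq_sub, ← smul_sub, inv_smul_smul₀ ht0.ne']
    rw [e1, e2, ← smul_sub, real_inner_smul_left, real_inner_smul_right]
    positivity
  constructor
  · rintro δ₁ δ₂ ξ₁ ⟨k₁, e₁, rfl⟩ ξ₂ ⟨k₂, e₂, rfl⟩
    change δ₁ = G k₁ at e₁
    change δ₂ = G k₂ at e₂
    subst e₁ e₂
    rw [apply_eq_inner_riesz_symm]
    convert hfirm k₁ k₂ using 2
    simp only [map_sub, LinearIsometryEquiv.symm_apply_apply]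
    abel
  · intro δ η hδ
    -- the point of the graph with the same image `k` under `δ ↦ δ + R⁻¹ η`
    set k := δ + riesz.symm η with hk
    have h1 := hδ (G k) (riesz (k - G k)) ⟨k, rfl, rfl⟩
    rw [apply_eq_inner_riesz_symm] at h1
    have e1 : riesz.symm (η - riesz (k - G k)) = -(δ - G k) := by
      rw [map_sub, LinearIsometryEquiv.symm_apply_apply, hk]; abel
    rw [e1, inner_neg_left, real_inner_self_eq_norm_sq] at h1
    have h2 : δ = G k := by
      rw [← sub_eq_zero, ← norm_eq_zero]
      exact pow_eq_zero_iff two_ne_zero |>.1 (le_antisymm (by linarith) (sq_nonneg _))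
    refine ⟨k, h2, ?_⟩
    simp [hk]

omit [CompleteSpace Y] in
theorem eventually_add_smul_mem_closedBall (y δ : Y) {ε : ℝ} (hε : 0 < ε) :
    ∀ᶠ t : ℝ in 𝓝[>] 0, y + t • δ ∈ closedBall y ε := by
  have hc : Continuous fun t : ℝ => y + t • δ := by fun_prop
  have h1 : ∀ᶠ t : ℝ in 𝓝 0, y + t • δ ∈ closedBall y ε :=
    hc.continuousAt.eventually_mem (by simpa using closedBall_mem_nhds y hε)
  exact h1.filter_mono nhdsWithin_le_nhds

omit [CompleteSpace Y] in
/-- The properties of `A (·, u)` are inherited by the directional derivative, with the same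
constants. -/
theorem stronglyMonotoneLipschitzOn_dirDeriv {A : Y × U → StrongDual ℝ Y} {y : Y} {u h : U}
    {ε μ L κ : ℝ} (hε : 0 < ε) (hA : DirDifferentiableAt A (y, u))
    (ha : ∀ᶠ t : ℝ in 𝓝[>] 0, StronglyMonotoneLipschitzOn (fun z => A (z, u + t • h))
      (closedBall y ε) μ L κ) :
    StronglyMonotoneLipschitzOn (fun δ => dirDeriv A (y, u) (δ, h)) univ μ L κ := by
  have hlim : ∀ δ₁ δ₂ : Y, Tendsto
      (fun t : ℝ => t⁻¹ • (A (y + t • δ₂, u + t • h) - A (y + t • δ₁, u + t • h)))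
      (𝓝[>] 0) (𝓝 (dirDeriv A (y, u) (δ₂, h) - dirDeriv A (y, u) (δ₁, h))) := by
    intro δ₁ δ₂
    refine ((hA.tendsto (δ₂, h)).sub (hA.tendsto (δ₁, h))).congr fun t => ?_
    simp only [Prod.smul_mk, Prod.mk_add_mk]
    module
  have hball := fun δ : Y => eventually_add_smul_mem_closedBall y δ hε
  have hdiff : ∀ (t : ℝ) (δ₁ δ₂ : Y), y + t • δ₂ - (y + t • δ₁) = t • (δ₂ - δ₁) := fun t δ₁ δ₂ => by
    module
  have happ : ∀ δ₁ δ₂ : Y, Tendsto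
      (fun t : ℝ => (t⁻¹ • (A (y + t • δ₂, u + t • h) - A (y + t • δ₁, u + t • h))) (δ₂ - δ₁))
      (𝓝[>] 0) (𝓝 ((dirDeriv A (y, u) (δ₂, h) - dirDeriv A (y, u) (δ₁, h)) (δ₂ - δ₁))) :=
    fun δ₁ δ₂ => (ContinuousLinearMap.apply ℝ ℝ (δ₂ - δ₁)).continuous.continuousAt.tendsto.comp
      (hlim δ₁ δ₂)
  refine ⟨fun δ₁ _ δ₂ _ => ge_of_tendsto (happ δ₁ δ₂) ?_,
    fun δ₁ _ δ₂ _ => le_of_tendsto (hlim δ₁ δ₂).norm ?_,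
    fun δ₁ _ δ₂ _ => le_of_tendsto_of_tendsto ((hlim δ₁ δ₂).norm.const_mul _)
      ((happ δ₁ δ₂).const_mul κ) ?_⟩
  all_goals
    filter_upwards [ha, hball δ₁, hball δ₂, self_mem_nhdsWithin] with t hat h₁ h₂ ht
    have ht0 : (0:ℝ) < t := ht
  · have h3 := hat.mono _ h₁ _ h₂
    rw [hdiff, norm_smul, Real.norm_of_nonneg ht0.le, map_smul, smul_eq_mul] at h3
    rw [smul_apply, smul_eq_mul, inv_mul_eq_div, le_div_iff₀ ht0]
    refine le_of_mul_le_mul_left ?_ ht0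
    linarith
  · have h3 := hat.lip _ h₁ _ h₂
    rw [hdiff, norm_smul, Real.norm_of_nonneg ht0.le] at h3
    rw [norm_smul, norm_inv, Real.norm_of_nonneg ht0.le, inv_mul_eq_div, div_le_iff₀ ht0]
    linarith
  · have h3 := hat.angle _ h₁ _ h₂
    rw [hdiff, norm_smul, Real.norm_of_nonneg ht0.le, map_smul, smul_eq_mul] at h3
    rw [smul_apply, smul_eq_mul, norm_smul, norm_inv, Real.norm_of_nonneg ht0.le]
    have h4 : ‖δ₂ - δ₁‖ * ‖A (y + t • δ₂, u + t • h) - A (y + t • δ₁, u + t • h)‖ ≤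
        κ * (A (y + t • δ₂, u + t • h) - A (y + t • δ₁, u + t • h)) (δ₂ - δ₁) := by
      refine le_of_mul_le_mul_left ?_ ht0
      linarith
    have h5 := mul_le_mul_of_nonneg_left h4 (inv_pos.2 ht0).le
    linarith

omit [CompleteSpace Y] in
/-- If `f (·, u + t h)` is `K`-Lipschitz near `y`, then the derivative of `f` in the direction of
a curve in `y` only depends on the tangent of the curve. -/
theorem DirDifferentiableAt.tendsto_curve {F : Type*} [NormedAddCommGroup F] [NormedSpace ℝ F]
    {f : Y × U → F} {y : Y} {u h : U} {ε K : ℝ} (hε : 0 < ε)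
    (hf : DirDifferentiableAt f (y, u))
    (hlip : ∀ᶠ t : ℝ in 𝓝[>] 0, ∀ y₁ ∈ closedBall y ε, ∀ y₂ ∈ closedBall y ε,
      ‖f (y₂, u + t • h) - f (y₁, u + t • h)‖ ≤ K * ‖y₂ - y₁‖)
    {x : ℝ → Y} {δ : Y} (hmem : ∀ᶠ t : ℝ in 𝓝[>] 0, x t ∈ closedBall y ε)
    (hx : Tendsto (fun t : ℝ => t⁻¹ • (x t - y)) (𝓝[>] 0) (𝓝 δ)) :
    Tendsto (fun t : ℝ => t⁻¹ • (f (x t, u + t • h) - f (y, u))) (𝓝[>] 0)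
      (𝓝 (dirDeriv f (y, u) (δ, h))) := by
  have hball := eventually_add_smul_mem_closedBall y δ hε
  have hrem : Tendsto (fun t : ℝ => t⁻¹ • (f (x t, u + t • h) - f (y + t • δ, u + t • h)))
      (𝓝[>] 0) (𝓝 0) := by
    have h0 : Tendsto (fun t : ℝ => K * ‖t⁻¹ • (x t - y) - δ‖) (𝓝[>] 0) (𝓝 0) := by
      simpa using ((hx.sub_const δ).norm).const_mul K
    refine squeeze_zero_norm' ?_ h0
    filter_upwards [hlip, hmem, hball, self_mem_nhdsWithin] with t h1 h2 h3 ht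
    have ht0 : (0:ℝ) < t := ht
    have h4 := h1 _ h3 _ h2
    have e : x t - (y + t • δ) = t • (t⁻¹ • (x t - y) - δ) := by
      rw [smul_sub, smul_inv_smul₀ ht0.ne']; abel
    rw [e, norm_smul, Real.norm_of_nonneg ht0.le] at h4
    rw [norm_smul, norm_inv, Real.norm_of_nonneg ht0.le, inv_mul_eq_div, div_le_iff₀ ht0]
    linarith
  have := hrem.add (hf.tendsto (δ, h))
  rw [zero_add] at this
  refine this.congr fun t => ?_
  simp only [Prod.smul_mk, Prod.mk_add_mk]
  module

omit [CompleteSpace Y] in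
theorem norm_dirDeriv_sub_le {f : Y × U → Y} {y : Y} {u h : U} {ε K : ℝ} (hε : 0 < ε)
    (hf : DirDifferentiableAt f (y, u))
    (hlip : ∀ᶠ t : ℝ in 𝓝[>] 0, ∀ y₁ ∈ closedBall y ε, ∀ y₂ ∈ closedBall y ε,
      ‖f (y₂, u + t • h) - f (y₁, u + t • h)‖ ≤ K * ‖y₂ - y₁‖) (δ₁ δ₂ : Y) :
    ‖dirDeriv f (y, u) (δ₂, h) - dirDeriv f (y, u) (δ₁, h)‖ ≤ K * ‖δ₂ - δ₁‖ := by
  have hball := fun δ : Y => eventually_add_smul_mem_closedBall y δ hε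
  refine le_of_tendsto ((hf.tendsto (δ₂, h)).sub (hf.tendsto (δ₁, h))).norm ?_
  filter_upwards [hlip, hball δ₁, hball δ₂, self_mem_nhdsWithin] with t h1 h2 h3 ht
  have ht0 : (0:ℝ) < t := ht
  have h4 := h1 _ h2 _ h3
  have e : y + t • δ₂ - (y + t • δ₁) = t • (δ₂ - δ₁) := by module
  rw [e, norm_smul, Real.norm_of_nonneg ht0.le] at h4
  simp only [Prod.smul_mk, Prod.mk_add_mk]
  rw [← smul_sub, sub_sub_sub_cancel_right, norm_smul, norm_inv, Real.norm_of_nonneg ht0.le,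
    inv_mul_eq_div, div_le_iff₀ ht0]
  linarith

/-- Directional differentiability of the solutions of `0 ∈ A (y, u) + B (y - φ, u)`. If `φ t` has
the right derivative `ψ`, then the solutions `x t` have the right derivative `δ` that solves
the linearized inclusion. The resolvent provides points of the graph of `B (·, u + t h)` for which
the residual of `y + t δ` is of order `o(t)`. -/
theorem tendsto_solution {A : Y × U → StrongDual ℝ Y} {B : Y × U → Set (StrongDual ℝ Y)}
    {y φ : Y} {u h : U} {ε μ L κ : ℝ} (hε : 0 < ε) (hμ : 0 < μ) (hL : 0 ≤ L)
    (hA : DirDifferentiableAt A (y, u))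
    (ha : ∀ᶠ t : ℝ in 𝓝[>] 0, StronglyMonotoneLipschitzOn (fun z => A (z, u + t • h))
      (closedBall y ε) μ L κ)
    (hBu : IsMaximallyMonotone fun z => B (z, u))
    (hB : ∀ᶠ t : ℝ in 𝓝[>] 0, IsMaximallyMonotone fun z => B (z, u + t • h))
    (hJ : DirDifferentiableAt (resolvent B) (y - φ + riesz.symm (-A (y, u)), u))
    (hsol : Solves A B φ u y) {f : ℝ → Y} {x : ℝ → Y} {ψ δ : Y}
    (hf : Tendsto (fun t : ℝ => t⁻¹ • (f t - φ)) (𝓝[>] 0) (𝓝 ψ))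
    (hmem : ∀ᶠ t : ℝ in 𝓝[>] 0, x t ∈ closedBall y ε)
    (hx : ∀ᶠ t : ℝ in 𝓝[>] 0, Solves A B (f t) (u + t • h) (x t))
    (hδ : SolvesLinearized A B y u φ h ψ δ) :
    Tendsto (fun t : ℝ => t⁻¹ • (x t - y)) (𝓝[>] 0) (𝓝 δ) := by
  obtain ⟨k, hk, hk'⟩ := hδ
  simp only at hk hk'
  set q := y - φ + riesz.symm (-A (y, u)) with hq
  set w : ℝ → Y := fun t => resolvent B (q + t • k, u + t • h) with hw
  have hw0 : resolvent B (q, u) = y - φ := resolvent_add_riesz_symm hBu hsol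
  have hwlim : Tendsto (fun t : ℝ => t⁻¹ • (w t - (y - φ))) (𝓝[>] 0) (𝓝 (δ - ψ)) := by
    rw [hk]
    refine (hJ.tendsto (k, h)).congr fun t => ?_
    simp [hw, hw0]
  have hball := eventually_add_smul_mem_closedBall y δ hε
  -- the two parts of the residual, divided by `t`
  have hlim1 : Tendsto (fun t : ℝ => t⁻¹ • (f t - φ) + t⁻¹ • (w t - (y - φ)) - δ) (𝓝[>] 0)
      (𝓝 0) := by
    simpa using (hf.add hwlim).sub_const δ
  have hlim2 : Tendsto (fun t : ℝ => riesz (k - t⁻¹ • (w t - (y - φ))) +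
      t⁻¹ • (A (y + t • δ, u + t • h) - A (y, u))) (𝓝[>] 0) (𝓝 0) := by
    have h1 := (riesz.continuous.tendsto _).comp (hwlim.const_sub k)
    have h2 := h1.add (hA.tendsto (δ, h))
    rw [← hk', neg_add_cancel] at h2
    exact h2
  have hlim : Tendsto (fun t : ℝ => ((L + 2) / μ + 1) *
      (‖t⁻¹ • (f t - φ) + t⁻¹ • (w t - (y - φ)) - δ‖ +
        ‖riesz (k - t⁻¹ • (w t - (y - φ))) + t⁻¹ • (A (y + t • δ, u + t • h) - A (y, u))‖))
      (𝓝[>] 0) (𝓝 0) := by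
    simpa using (hlim1.norm.add hlim2.norm).const_mul ((L + 2) / μ + 1)
  rw [← tendsto_sub_nhds_zero_iff]
  refine squeeze_zero_norm' ?_ hlim
  filter_upwards [ha, hB, hmem, hball, hx, self_mem_nhdsWithin] with t hat hBt hxt hyt hst ht
  have ht0 : (0:ℝ) < t := ht
  have h1 := hat.norm_sub_le_residual hBt hμ hL hxt hyt hst
    (neg_riesz_resolvent_sub_mem hBt (q + t • k))
  have e1 : f t + resolvent B (q + t • k, u + t • h) - (y + t • δ) =
      t • (t⁻¹ • (f t - φ) + t⁻¹ • (w t - (y - φ)) - δ) := by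
    rw [smul_sub, smul_add, smul_inv_smul₀ ht0.ne', smul_inv_smul₀ ht0.ne']
    simp only [hw]
    abel
  have e2 : -riesz (resolvent B (q + t • k, u + t • h) - (q + t • k)) + A (y + t • δ, u + t • h) =
      t • (riesz (k - t⁻¹ • (w t - (y - φ))) +
        t⁻¹ • (A (y + t • δ, u + t • h) - A (y, u))) := by
    have e3 : t • riesz (k - t⁻¹ • (w t - (y - φ))) = riesz (t • k - (w t - (y - φ))) := by
      rw [← smul_inv_smul₀ ht0.ne' (w t - (y - φ)), ← smul_sub, map_smulₛₗ, conj_trivial,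
        inv_smul_smul₀ ht0.ne']
    rw [smul_add, smul_inv_smul₀ ht0.ne', e3, hq]
    simp only [hw, map_sub, map_add, LinearIsometryEquiv.apply_symm_apply]
    abel
  rw [e1, e2, norm_smul, norm_smul, Real.norm_of_nonneg ht0.le, ← mul_add] at h1
  have e4 : t⁻¹ • (x t - y) - δ = t⁻¹ • (x t - (y + t • δ)) := by
    rw [← sub_sub, smul_sub t⁻¹ (x t - y), inv_smul_smul₀ ht0.ne']
  rw [e4, norm_smul, norm_inv, Real.norm_of_nonneg ht0.le, inv_mul_eq_div, div_le_iff₀ ht0]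
  linarith

end Linearization
end QGE

/-! ### The iteration for a fixed parameter -/

namespace QGE
section Iteration
open Metric

variable {Y U : Type*} [NormedAddCommGroup Y] [InnerProductSpace ℝ Y]

theorem stronglyMonotoneLipschitzOn_of_lipschitz {a : Y → StrongDual ℝ Y} {s : Set Y} {μ L : ℝ}
    (hμ : 0 < μ) (hL : 0 ≤ L)
    (hmono : ∀ y₁ ∈ s, ∀ y₂ ∈ s, μ * ‖y₂ - y₁‖ ^ 2 ≤ (a y₂ - a y₁) (y₂ - y₁))
    (hlip : ∀ y₁ ∈ s, ∀ y₂ ∈ s, ‖a y₂ - a y₁‖ ≤ L * ‖y₂ - y₁‖) :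
    StronglyMonotoneLipschitzOn a s μ L (L / μ) := by
  refine ⟨hmono, hlip, fun y₁ h₁ y₂ h₂ => ?_⟩
  have h3 := hmono y₁ h₁ y₂ h₂
  rw [div_mul_eq_mul_div, le_div_iff₀ hμ]
  calc ‖y₂ - y₁‖ * ‖a y₂ - a y₁‖ * μ ≤ ‖y₂ - y₁‖ * (L * ‖y₂ - y₁‖) * μ := by
        gcongr; exact hlip y₁ h₁ y₂ h₂
    _ = L * (μ * ‖y₂ - y₁‖ ^ 2) := by ring
    _ ≤ _ := by gcongr

/-- Either smallness condition on `LΦ` makes `κ * LΦ` smaller than one, where `κ` is the constant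
of the angle condition. The Lipschitz constant may be enlarged to exceed `μ`; this only matters if
`Y` is trivial. -/
theorem exists_stronglyMonotoneLipschitzOn [CompleteSpace Y]
    {A : Y × U → StrongDual ℝ Y} {ys : Y} {𝒰 : Set U} {ε μ LA LΦ : ℝ}
    (hε : 0 < ε) (hμ : 0 < μ) (hLA : 0 < LA) (hLΦ : LΦ ∈ Ico (0 : ℝ) 1)
    (hmono : ∀ u ∈ 𝒰, ∀ y₁ ∈ closedBall ys ε, ∀ y₂ ∈ closedBall ys ε,
      μ * ‖y₂ - y₁‖ ^ 2 ≤ (A (y₂, u) - A (y₁, u)) (y₂ - y₁))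
    (hlip : ∀ u ∈ 𝒰, ∀ y₁ ∈ closedBall ys ε, ∀ y₂ ∈ closedBall ys ε,
      ‖A (y₂, u) - A (y₁, u)‖ ≤ LA * ‖y₂ - y₁‖)
    (hsmall : LΦ < (LA / μ)⁻¹ ∨
      (LΦ < 2 * √(LA / μ) / (1 + LA / μ) ∧
        ∃ g : Y × U → ℝ, ∀ u ∈ 𝒰, ∀ y ∈ ball ys ε,
          HasFDerivAt (fun z => g (z, u)) (A (y, u)) y)) :
    ∃ L κ : ℝ, μ ≤ L ∧ 0 ≤ κ ∧ κ * LΦ < 1 ∧ ∀ u ∈ 𝒰,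
      StronglyMonotoneLipschitzOn (fun y => A (y, u)) (closedBall ys ε) μ L κ := by
  rcases lt_or_ge LA μ with hlt | hge
  · refine ⟨μ, 1, le_rfl, zero_le_one, by simpa using hLΦ.2, fun u hu => ?_⟩
    rw [← div_self hμ.ne']
    refine stronglyMonotoneLipschitzOn_of_lipschitz hμ hμ.le (hmono u hu)
      fun y₁ h₁ y₂ h₂ => (hlip u hu y₁ h₁ y₂ h₂).trans ?_
    gcongr
  have hγ : 0 < LA / μ := by positivity
  rcases hsmall with hs | ⟨hs, g, hg⟩
  · refine ⟨LA, LA / μ, hge, hγ.le, ?_, fun u hu =>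
      stronglyMonotoneLipschitzOn_of_lipschitz hμ hLA.le (hmono u hu) (hlip u hu)⟩
    calc LA / μ * LΦ < LA / μ * (LA / μ)⁻¹ := by gcongr
      _ = 1 := mul_inv_cancel₀ hγ.ne'
  · have hsq : 0 < √(LA / μ) := Real.sqrt_pos.2 hγ
    refine ⟨LA, (1 + LA / μ) / (2 * √(LA / μ)), hge, by positivity, ?_, fun u hu =>
      ⟨hmono u hu, hlip u hu, fun y₁ h₁ y₂ h₂ => ?_⟩⟩
    · rw [lt_div_iff₀ (by positivity)] at hs
      rw [div_mul_eq_mul_div, div_lt_one (by positivity)]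
      linarith
    · refine norm_mul_norm_le_of_norm_sub_smul_le hμ hLA ?_
      have h3 := norm_sub_sub_smul_riesz_le_closedBall hε (hg u hu) (hmono u hu) (hlip u hu) hge
        hLA.le h₁ h₂
      convert h3 using 2
      rw [map_sub, smul_sub]
      abel

/-- The iteration for a fixed parameter: if the first iterate is close to the starting point `c`,
then the solution operator of `0 ∈ a y + T (y - φ z)` maps the closed ball of radius `ρ` into
itself and is a contraction, whence the iterates converge geometrically to a solution. -/
theorem StronglyMonotoneLipschitzOn.exists_iteration [CompleteSpace Y]
    {T : Y → Set (StrongDual ℝ Y)} {a : Y → StrongDual ℝ Y} {c : Y} {ε μ L κ : ℝ}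
    (ha : StronglyMonotoneLipschitzOn a (closedBall c ε) μ L κ) (hT : IsMaximallyMonotone T)
    (hμ : 0 < μ) (hμL : μ ≤ L) (hκ : 0 ≤ κ) {φ : Y → Y} {K : ℝ} (hK : 0 ≤ K) (hκK : κ * K < 1)
    (hφ : ∀ y₁ ∈ closedBall c ε, ∀ y₂ ∈ closedBall c ε, ‖φ y₂ - φ y₁‖ ≤ K * ‖y₂ - y₁‖)
    {ρ : ℝ} (hρ : 0 < ρ) (hρε : ρ < ε) {y₁ : Y} (hy₁ : ‖y₁ - c‖ ≤ (1 - κ * K) * ρ)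
    (hs₁ : -a y₁ ∈ T (y₁ - φ c)) :
    ∃ (y : Y) (x : ℕ → Y), y ∈ closedBall c ρ ∧ -a y ∈ T (y - φ y) ∧ x 0 = c ∧
      (∀ n, x n ∈ closedBall c ρ) ∧ (∀ n, -a (x (n + 1)) ∈ T (x (n + 1) - φ (x n))) ∧
      ∀ n, ‖x n - y‖ ≤ ‖y₁ - c‖ / (1 - κ * K) * (κ * K) ^ n := by
  have hq0 : 0 ≤ κ * K := mul_nonneg hκ hK
  have hsub : closedBall c ρ ⊆ closedBall c ε := closedBall_subset_closedBall hρε.le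
  have hcρ : c ∈ closedBall c ρ := mem_closedBall_self hρ.le
  have hy₁ε : y₁ ∈ closedBall c ε := by
    rw [mem_closedBall, dist_eq_norm]; nlinarith
  have hdist : ∀ z ∈ closedBall c ρ, ∀ z' ∈ closedBall c ρ, ∀ y ∈ closedBall c ε,
      ∀ y' ∈ closedBall c ε, -a y ∈ T (y - φ z) → -a y' ∈ T (y' - φ z') →
      ‖y' - y‖ ≤ κ * K * ‖z' - z‖ := by
    intro z hz z' hz' y hy y' hy' h h'
    calc ‖y' - y‖ ≤ κ * ‖φ z' - φ z‖ := ha.norm_solution_sub_le hT hμ hκ hy hy' h h'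
      _ ≤ κ * (K * ‖z' - z‖) := by gcongr; exact hφ z (hsub hz) z' (hsub hz')
      _ = _ := by ring
  have hstep : ∀ z ∈ closedBall c ρ, ∃ y ∈ closedBall c ρ, -a y ∈ T (y - φ z) := by
    intro z hz
    have hz' : ‖z - c‖ ≤ ρ := by rwa [← dist_eq_norm]
    have h1 : κ * ‖φ z - φ c‖ ≤ κ * K * ρ := by
      calc κ * ‖φ z - φ c‖ ≤ κ * (K * ‖z - c‖) := by gcongr; exact hφ c (hsub hcρ) z (hsub hz)
        _ = κ * K * ‖z - c‖ := by ring
        _ ≤ _ := by gcongr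
    obtain ⟨y, hy, hs⟩ := ha.exists_solution_of_norm_lt hT hμ hμL hκ (φ := φ z) hs₁ (by linarith)
    refine ⟨y, ?_, hs⟩
    have h2 := ha.norm_solution_sub_le hT hμ hκ hy₁ε hy hs₁ hs
    have h3 := norm_sub_le_norm_sub_add_norm_sub y y₁ c
    rw [mem_closedBall, dist_eq_norm]
    linarith
  choose! S hSmem hS using hstep
  obtain ⟨y, hy, hfix⟩ := exists_isFixedPt_of_dist_le isClosed_closedBall ⟨c, hcρ⟩ hSmem hq0 hκK
    fun z hz z' hz' => by
      rw [dist_eq_norm, dist_eq_norm]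
      exact hdist z' hz' z hz _ (hsub (hSmem z' hz')) _ (hsub (hSmem z hz)) (hS z' hz') (hS z hz)
  have hsy : -a y ∈ T (y - φ y) := by
    have := hS y hy
    rwa [hfix] at this
  have hcy : ‖c - y‖ ≤ ‖y₁ - c‖ / (1 - κ * K) := by
    have h1 := hdist y hy c hcρ y (hsub hy) y₁ hy₁ε hsy hs₁
    have h2 := norm_sub_le_norm_sub_add_norm_sub c y₁ y
    rw [norm_sub_rev c y₁] at h2
    rw [le_div_iff₀ (by linarith)]
    linarith
  have hxmem : ∀ n, S^[n] c ∈ closedBall c ρ := by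
    intro n
    induction n with
    | zero => exact hcρ
    | succ n ih => rw [Function.iterate_succ_apply']; exact hSmem _ ih
  have hxs : ∀ n, -a (S^[n + 1] c) ∈ T (S^[n + 1] c - φ (S^[n] c)) := fun n => by
    rw [Function.iterate_succ_apply']; exact hS _ (hxmem n)
  refine ⟨y, fun n => S^[n] c, hy, hsy, rfl, hxmem, hxs, fun n => ?_⟩
  induction n with
  | zero => simpa using hcy
  | succ n ih =>
    calc _ ≤ κ * K * ‖S^[n] c - y‖ := hdist y hy _ (hxmem n) y (hsub hy) _ (hsub (hxmem (n + 1)))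
            hsy (hxs n)
      _ ≤ κ * K * (‖y₁ - c‖ / (1 - κ * K) * (κ * K) ^ n) := by gcongr
      _ = _ := by ring

end Iteration
end QGE

/-! ### The linearized iteration and the exchange of limits -/

namespace QGE
section Linearized
open Metric

variable {Y U : Type*} [NormedAddCommGroup Y] [InnerProductSpace ℝ Y] [CompleteSpace Y]
  [NormedAddCommGroup U] [NormedSpace ℝ U]

/-- The linearized iteration. For fixed `ψ` the linearized inclusion is of the same form as the
original one, with `A' (·, h)` in place of `A (·, u)` and the linearization in place of `B (·, u)`,
hence its solution operator is defined on all of `Y` and `κ`-Lipschitz. -/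
theorem exists_linearized_iteration {A : Y × U → StrongDual ℝ Y} {B : Y × U → Set (StrongDual ℝ Y)}
    {y φ : Y} {u h : U} {μ L κ : ℝ} (hμ : 0 < μ) (hμL : μ ≤ L) (hκ : 0 ≤ κ)
    (ha : StronglyMonotoneLipschitzOn (fun δ => dirDeriv A (y, u) (δ, h)) univ μ L κ)
    (hT : IsMaximallyMonotone fun δ => linearization B (y - φ) u (-A (y, u)) (δ, h))
    {P : Y → Y} {K : ℝ} (hK : 0 ≤ K) (hκK : κ * K < 1)
    (hP : ∀ δ₁ δ₂ : Y, ‖P δ₂ - P δ₁‖ ≤ K * ‖δ₂ - δ₁‖) :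
    ∃ (δ : Y) (x : ℕ → Y), x 0 = 0 ∧
      (∀ n, SolvesLinearized A B y u φ h (P (x n)) (x (n + 1)) ∧
        ∀ d : Y, SolvesLinearized A B y u φ h (P (x n)) d → d = x (n + 1)) ∧
      Tendsto x atTop (𝓝 δ) ∧ SolvesLinearized A B y u φ h (P δ) δ ∧
      ∀ d : Y, SolvesLinearized A B y u φ h (P d) d → d = δ := by
  have hdist : ∀ {ψ₁ ψ₂ δ₁ δ₂ : Y}, SolvesLinearized A B y u φ h ψ₁ δ₁ →
      SolvesLinearized A B y u φ h ψ₂ δ₂ → ‖δ₂ - δ₁‖ ≤ κ * ‖ψ₂ - ψ₁‖ := fun h₁ h₂ =>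
    ha.norm_solution_sub_le hT hμ hκ (mem_univ _) (mem_univ _) h₁ h₂
  have hex : ∀ ψ : Y, ∃ δ, SolvesLinearized A B y u φ h ψ δ := fun ψ =>
    ha.exists_solution hT hμ hμL ψ
  choose S hS using hex
  have huniq : ∀ {ψ d : Y}, SolvesLinearized A B y u φ h ψ d → d = S ψ := fun {ψ d} hd => by
    have := hdist (hS ψ) hd
    rw [sub_self, norm_zero, mul_zero] at this
    exact sub_eq_zero.1 (norm_le_zero_iff.1 this)
  have hSP : ∀ x z : Y, ‖S (P x) - S (P z)‖ ≤ κ * K * ‖x - z‖ := fun x z =>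
    calc _ ≤ κ * ‖P x - P z‖ := hdist (hS _) (hS _)
      _ ≤ κ * (K * ‖x - z‖) := by gcongr; exact hP z x
      _ = _ := by ring
  have hc : ContractingWith ⟨κ * K, mul_nonneg hκ hK⟩ fun d => S (P d) :=
    ⟨by exact_mod_cast hκK, LipschitzWith.of_dist_le_mul fun x z => by
      rw [dist_eq_norm, dist_eq_norm]
      exact hSP x z⟩
  set δ := ContractingWith.fixedPoint _ hc
  have hfix : S (P δ) = δ := hc.fixedPoint_isFixedPt
  refine ⟨δ, fun n => (fun d => S (P d))^[n] 0, rfl, fun n => ?_, hc.tendsto_iterate_fixedPoint 0,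
    ?_, fun d hd => ?_⟩
  · simp only [Function.iterate_succ_apply']
    exact ⟨hS _, fun d hd => huniq hd⟩
  · simpa only [hfix] using hS (P δ)
  · exact hc.fixedPoint_unique (huniq hd).symm

end Linearized
end QGE

open QGE in
theorem mainTheorem4
    {Y U : Type*} [NormedAddCommGroup Y] [InnerProductSpace ℝ Y] [CompleteSpace Y]
    [NormedAddCommGroup U] [NormedSpace ℝ U] [CompleteSpace U]
    (A : Y × U → StrongDual ℝ Y) (B : Y × U → Set (StrongDual ℝ Y)) (Φ : Y × U → Y)
    (ys : Y) (us : U) (𝒰 : Set U) (h𝒰 : 𝒰 ∈ 𝓝 us)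
    (ε μA LA LΦ : ℝ) (hε : 0 < ε) (hμA : 0 < μA) (hLA : 0 < LA) (hLΦ : LΦ ∈ Ico (0 : ℝ) 1)
    -- `A(·, u)` is strongly monotone and Lipschitz near `ys`, uniformly in `u ∈ 𝒰`
    (hA_mono : ∀ u ∈ 𝒰, ∀ y₁ ∈ Metric.closedBall ys ε, ∀ y₂ ∈ Metric.closedBall ys ε,
      μA * ‖y₂ - y₁‖ ^ 2 ≤ (A (y₂, u) - A (y₁, u)) (y₂ - y₁))
    (hA_lip : ∀ u ∈ 𝒰, ∀ y₁ ∈ Metric.closedBall ys ε, ∀ y₂ ∈ Metric.closedBall ys ε,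
      ‖A (y₂, u) - A (y₁, u)‖ ≤ LA * ‖y₂ - y₁‖)
    -- `B(·, u)` is maximally monotone
    (hB : ∀ u ∈ 𝒰, QGE.IsMaximallyMonotone fun y => B (y, u))
    -- `(ys, us)` is a solution of the quasi-generalized equation
    (hsol : QGE.Solves A B (Φ (ys, us)) us ys)
    -- `Φ` is continuous at `(ys, us)` and `Φ(·, u)` is a contraction near `ys`
    (hΦ_cont : ContinuousAt Φ (ys, us))
    (hΦ_lip : ∀ u ∈ 𝒰, ∀ y₁ ∈ Metric.closedBall ys ε, ∀ y₂ ∈ Metric.closedBall ys ε,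
      ‖Φ (y₂, u) - Φ (y₁, u)‖ ≤ LΦ * ‖y₂ - y₁‖)
    -- smallness of `LΦ` relative to the condition number `LA / μA`
    (hsmall : LΦ < (LA / μA)⁻¹ ∨
      (LΦ < 2 * √(LA / μA) / (1 + LA / μA) ∧
        ∃ g : Y × U → ℝ, ∀ u ∈ 𝒰, ∀ y ∈ Metric.ball ys ε,
          HasFDerivAt (fun z => g (z, u)) (A (y, u)) y))
    -- directional differentiability of `A`, of the resolvent of `B`, and of `Φ`
    (hA_diff : QGE.DirDifferentiableAt A (ys, us))
    (hJ_diff : QGE.DirDifferentiableAt (QGE.resolvent B)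
      (ys - QGE.riesz.symm (A (ys, us)) - Φ (ys, us), us))
    (hΦ_diff : QGE.DirDifferentiableAt Φ (ys, us)) :
    ∃ c ∈ Ioo (0 : ℝ) 1, ∀ lam ∈ Ioc (0 : ℝ) ε, ∀ h : U,
      ∃ t₀ > (0 : ℝ), ∃ C ≥ (0 : ℝ), ∃ (y : ℝ → Y) (yit : ℕ → ℝ → Y) (δ : Y) (δit : ℕ → Y),
        -- `y t` is the unique solution of the quasi-generalized equation
        (∀ t ∈ Icc 0 t₀, us + t • h ∈ 𝒰 ∧
          y t ∈ Metric.closedBall ys lam ∧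
          QGE.Solves A B (Φ (y t, us + t • h)) (us + t • h) (y t) ∧
          ∀ z ∈ Metric.closedBall ys ε,
            QGE.Solves A B (Φ (z, us + t • h)) (us + t • h) z → z = y t) ∧
        -- the iteration is well defined in the closed `ε`-ball
        (∀ t ∈ Icc 0 t₀, yit 0 t = ys ∧ ∀ n : ℕ,
          yit (n + 1) t ∈ Metric.closedBall ys ε ∧
          QGE.Solves A B (Φ (yit n t, us + t • h)) (us + t • h) (yit (n + 1) t) ∧
          ∀ z ∈ Metric.closedBall ys ε,
            QGE.Solves A B (Φ (yit n t, us + t • h)) (us + t • h) z → z = yit (n + 1) t) ∧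
        -- it converges to `y t`, uniformly in `t`
        (∀ t ∈ Icc 0 t₀, ∀ n : ℕ, ‖yit n t - y t‖ ≤ C * t * c ^ n) ∧
        -- every iterate is directionally differentiable
        δit 0 = 0 ∧
        (∀ n : ℕ, QGE.SolvesLinearized A B ys us (Φ (ys, us)) h
            (QGE.dirDeriv Φ (ys, us) (δit n, h)) (δit (n + 1)) ∧
          ∀ d : Y, QGE.SolvesLinearized A B ys us (Φ (ys, us)) h
            (QGE.dirDeriv Φ (ys, us) (δit n, h)) d → d = δit (n + 1)) ∧
        (∀ n : ℕ, Tendsto (fun t : ℝ => t⁻¹ • (yit n t - ys)) (𝓝[>] 0) (𝓝 (δit n))) ∧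
        -- the limits can be exchanged
        Tendsto δit atTop (𝓝 δ) ∧
        Tendsto (fun t : ℝ => t⁻¹ • (y t - ys)) (𝓝[>] 0) (𝓝 δ) ∧
        -- the limit is the unique solution of the linearized equation
        QGE.SolvesLinearized A B ys us (Φ (ys, us)) h (QGE.dirDeriv Φ (ys, us) (δ, h)) δ ∧
        ∀ d : Y, QGE.SolvesLinearized A B ys us (Φ (ys, us)) h
          (QGE.dirDeriv Φ (ys, us) (d, h)) d → d = δ := by
  obtain ⟨L, κ, hμL, hκ, hκL, ha⟩ :=
    exists_stronglyMonotoneLipschitzOn hε hμA hLA hLΦ hA_mono hA_lip hsmall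
  have hL : 0 < L := hμA.trans_le hμL
  have hq0 : 0 ≤ κ * LΦ := mul_nonneg hκ hLΦ.1
  refine ⟨(1 + κ * LΦ) / 2, ⟨by linarith, by linarith⟩, fun lam hlam h => ?_⟩
  -- the ray of parameters
  have hray : ∀ᶠ t : ℝ in 𝓝[≥] 0, us + t • h ∈ 𝒰 := by
    have hc : Continuous fun t : ℝ => us + t • h := by fun_prop
    have h1 : ∀ᶠ t : ℝ in 𝓝 0, us + t • h ∈ 𝒰 :=
      hc.continuousAt.eventually_mem (by simpa using h𝒰)
    exact h1.filter_mono nhdsWithin_le_nhds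
  have hus : us ∈ 𝒰 := mem_of_mem_nhds h𝒰
  set Φs := Φ (ys, us) with hΦs
  set q := ys - Φs + riesz.symm (-A (ys, us)) with hq
  have hJ : DirDifferentiableAt (resolvent B) (q, us) := by
    convert hJ_diff using 2
    rw [hq, map_neg]
    abel
  have hJq : resolvent B (q, us) = ys - Φs := resolvent_add_riesz_symm (hB us hus) hsol
  -- the residual of `ys` at the parameter `us + t h` is of order `t`
  set w : ℝ → Y := fun t => resolvent B (q, us + t • h) with hw
  obtain ⟨R, hR, hres⟩ : ∃ R ≥ (0 : ℝ), ∀ᶠ t : ℝ in 𝓝[≥] 0,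
      ‖Φ (ys, us + t • h) + w t - ys‖ +
        ‖-riesz (w t - q) + A (ys, us + t • h)‖ ≤ R * t := by
    obtain ⟨C₁, hC₁, h₁⟩ := hΦ_diff.exists_eventually_norm_sub_le (0, h)
    obtain ⟨C₂, hC₂, h₂⟩ := hJ.exists_eventually_norm_sub_le (0, h)
    obtain ⟨C₃, hC₃, h₃⟩ := hA_diff.exists_eventually_norm_sub_le (0, h)
    refine ⟨C₁ + C₂ + (C₂ + C₃), by positivity, ?_⟩
    filter_upwards [h₁, h₂, h₃] with t h₁ h₂ h₃
    simp only [Prod.smul_mk, Prod.mk_add_mk, smul_zero, add_zero, hJq] at h₁ h₂ h₃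
    have e1 : Φ (ys, us + t • h) + w t - ys = (Φ (ys, us + t • h) - Φs) + (w t - (ys - Φs)) := by
      abel
    have e2 : -riesz (w t - q) + A (ys, us + t • h) =
        -riesz (w t - (ys - Φs)) + (A (ys, us + t • h) - A (ys, us)) := by
      simp only [hq, map_sub, map_add, LinearIsometryEquiv.apply_symm_apply]
      abel
    have h4 := norm_add_le (Φ (ys, us + t • h) - Φs) (w t - (ys - Φs))
    have h5 := norm_add_le (-riesz (w t - (ys - Φs))) (A (ys, us + t • h) - A (ys, us))
    rw [norm_neg, LinearIsometryEquiv.norm_map] at h5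
    rw [e1, e2]
    linarith
  obtain ⟨θ, hθ, hloc⟩ := exists_forall_exists_solution_mem_closedBall (Y := Y) hμA hμL
  -- half of `lam` leaves room for the continuation argument inside the closed `ε`-ball
  set ρ := lam / 2 with hρdef
  have hρ : 0 < ρ := half_pos hlam.1
  have hρlam : ρ ≤ lam := half_le_self hlam.1.le
  have hρε : ρ < ε := (half_lt_self hlam.1).trans_le hlam.2
  set r := (1 - κ * LΦ) * ρ with hr
  have hr0 : 0 < r := mul_pos (by linarith) hρ
  have hrρ : r ≤ ρ := mul_le_of_le_one_left hρ.le (by linarith)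
  have hsmallt : ∀ᶠ t : ℝ in 𝓝[≥] 0, R * t ≤ θ * r := by
    have hc : Continuous fun t : ℝ => R * t := by fun_prop
    have h1 : ∀ᶠ t : ℝ in 𝓝 0, R * t < θ * r :=
      hc.continuousAt.eventually_lt_const (by simpa using mul_pos hθ hr0)
    exact (h1.filter_mono nhdsWithin_le_nhds).mono fun t ht => ht.le
  obtain ⟨t₀, ht₀, hsub⟩ := mem_nhdsGE_iff_exists_Icc_subset.1 (hray.and (hres.and hsmallt))
  set M := (L + 2) / μA + 1 with hM
  have hM0 : 0 ≤ M := by positivity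
  have hball : Metric.closedBall ys ρ ⊆ Metric.closedBall ys ε :=
    Metric.closedBall_subset_closedBall hρε.le
  -- the iteration for a fixed `t`
  have hiter : ∀ t ∈ Icc 0 t₀, ∃ (y : Y) (x : ℕ → Y), y ∈ Metric.closedBall ys ρ ∧
      Solves A B (Φ (y, us + t • h)) (us + t • h) y ∧ x 0 = ys ∧
      (∀ n, x n ∈ Metric.closedBall ys ρ) ∧
      (∀ n, Solves A B (Φ (x n, us + t • h)) (us + t • h) (x (n + 1))) ∧
      ∀ n, ‖x n - y‖ ≤ M * R / (1 - κ * LΦ) * t * (κ * LΦ) ^ n := by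
    intro t ht
    obtain ⟨hut, hrest, hst⟩ := hsub ht
    have hys : ys ∈ Metric.closedBall ys ε := Metric.mem_closedBall_self hε.le
    obtain ⟨y₁, hy₁, hs₁⟩ := hloc (hB _ hut) (ha _ hut) hr0.le
      ((Metric.closedBall_subset_closedBall hrρ).trans hball)
      (neg_riesz_resolvent_sub_mem (hB _ hut) q) (hrest.trans hst)
    rw [Metric.mem_closedBall, dist_eq_norm] at hy₁
    obtain ⟨y, x, hy, hsy, hx0, hx, hxs, hconv⟩ := (ha _ hut).exists_iteration (hB _ hut) hμA hμL hκ
      (φ := fun z => Φ (z, us + t • h)) hLΦ.1 hκL (hΦ_lip _ hut) hρ hρε hy₁ hs₁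
    refine ⟨y, x, hy, hsy, hx0, hx, hxs, fun n => (hconv n).trans ?_⟩
    have h1 := (ha _ hut).norm_sub_le_residual (hB _ hut) hμA hL.le
      (by rw [Metric.mem_closedBall, dist_eq_norm]; linarith) hys hs₁
      (neg_riesz_resolvent_sub_mem (hB _ hut) q)
    have h2 : ‖y₁ - ys‖ ≤ M * R * t := by
      calc _ ≤ M * (R * t) := h1.trans (by gcongr)
        _ = _ := by ring
    have h3 : 0 < 1 - κ * LΦ := by linarith
    rw [div_mul_eq_mul_div (M * R)]
    gcongr
  choose! y x hymem hysol hx0 hxmem hxsol hconv using hiter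
  -- the linearized iteration
  have hIoc : Ioc 0 t₀ ∈ 𝓝[>] (0 : ℝ) := Ioc_mem_nhdsGT ht₀
  have hIcc : ∀ᶠ t : ℝ in 𝓝[>] 0, t ∈ Icc 0 t₀ :=
    mem_of_superset hIoc Ioc_subset_Icc_self
  have hray' : ∀ᶠ t : ℝ in 𝓝[>] 0, us + t • h ∈ 𝒰 := hIcc.mono fun t ht => (hsub ht).1
  have ha' : ∀ᶠ t : ℝ in 𝓝[>] 0, StronglyMonotoneLipschitzOn (fun z => A (z, us + t • h))
      (Metric.closedBall ys ε) μA L κ := hray'.mono fun t ht => ha _ ht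
  have hB' : ∀ᶠ t : ℝ in 𝓝[>] 0, IsMaximallyMonotone fun z => B (z, us + t • h) :=
    hray'.mono fun t ht => hB _ ht
  have hΦ' : ∀ᶠ t : ℝ in 𝓝[>] 0, ∀ y₁ ∈ Metric.closedBall ys ε, ∀ y₂ ∈ Metric.closedBall ys ε,
      ‖Φ (y₂, us + t • h) - Φ (y₁, us + t • h)‖ ≤ LΦ * ‖y₂ - y₁‖ :=
    hray'.mono fun t ht => hΦ_lip _ ht
  obtain ⟨δ, δit, hδ0, hδit, hδlim, hδ, hδuniq⟩ :=
    exists_linearized_iteration (y := ys) (φ := Φs) (u := us) (h := h) hμA hμL hκ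
      (stronglyMonotoneLipschitzOn_dirDeriv hε hA_diff ha')
      (isMaximallyMonotone_linearization hJ hB') (P := fun d => dirDeriv Φ (ys, us) (d, h))
      hLΦ.1 hκL (norm_dirDeriv_sub_le hε hΦ_diff hΦ')
  have hxlim : ∀ n, Tendsto (fun t : ℝ => t⁻¹ • (x t n - ys)) (𝓝[>] 0) (𝓝 (δit n)) := by
    intro n
    induction n with
    | zero =>
      rw [hδ0]
      refine tendsto_const_nhds.congr' ?_
      filter_upwards [hIcc] with t ht
      rw [hx0 t ht, sub_self, smul_zero]
    | succ n ih =>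
      have hmem : ∀ k, ∀ᶠ t : ℝ in 𝓝[>] 0, x t k ∈ Metric.closedBall ys ε := fun k =>
        hIcc.mono fun t ht => hball (hxmem t ht k)
      exact tendsto_solution hε hμA hL.le hA_diff ha' (hB us hus) hB' hJ hsol
        (hΦ_diff.tendsto_curve hε hΦ' (hmem n) ih) (hmem (n + 1))
        (hIcc.mono fun t ht => hxsol t ht n) (hδit n).1
  set C := M * R / (1 - κ * LΦ) with hC
  have hC0 : 0 ≤ C := div_nonneg (by positivity) (by linarith)
  -- the difference quotients of the iterates converge uniformly in `t`
  have hunif : TendstoUniformlyOnFilter (fun n t => t⁻¹ • (x t n - ys))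
      (fun t => t⁻¹ • (y t - ys)) atTop (𝓝[>] (0 : ℝ)) := by
    have hpow : Tendsto (fun n => C * (κ * LΦ) ^ n) atTop (𝓝 0) := by
      simpa using (tendsto_pow_atTop_nhds_zero_of_lt_one hq0 hκL).const_mul C
    rw [Metric.tendstoUniformlyOnFilter_iff]
    intro e he
    filter_upwards [(hpow.eventually_lt_const he).prod_mk hIoc] with p hp
    obtain ⟨hp1, hp2⟩ := hp
    have ht0 : 0 < p.2 := hp2.1
    refine lt_of_le_of_lt ?_ hp1
    rw [dist_comm, dist_eq_norm, ← smul_sub, sub_sub_sub_cancel_right, norm_smul, norm_inv,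
      Real.norm_of_nonneg ht0.le, inv_mul_eq_div, div_le_iff₀ ht0]
    linarith [hconv p.2 (Ioc_subset_Icc_self hp2) p.1]
  refine ⟨t₀, ht₀, C, hC0, y, fun n t => x t n, δ, δit, fun t ht => ?_, fun t ht => ?_,
    fun t ht n => ?_, hδ0, hδit, hxlim, hδlim,
    hunif.tendsto_of_eventually_tendsto (Eventually.of_forall hxlim) hδlim, hδ, hδuniq⟩
  · have hut := (hsub ht).1
    refine ⟨hut, Metric.closedBall_subset_closedBall hρlam (hymem t ht), hysol t ht,
      fun z hz hzs => ?_⟩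
    have h1 := (ha _ hut).norm_solution_sub_le (hB _ hut) hμA hκ (hball (hymem t ht)) hz
      (hysol t ht) hzs
    have h2 := hΦ_lip _ hut _ (hball (hymem t ht)) _ hz
    have h3 := mul_le_mul_of_nonneg_left h2 hκ
    have h4 := norm_nonneg (z - y t)
    rw [← sub_eq_zero, ← norm_eq_zero]
    nlinarith
  · have hut := (hsub ht).1
    refine ⟨hx0 t ht, fun n => ⟨hball (hxmem t ht (n + 1)), hxsol t ht n, fun z hz hzs => ?_⟩⟩
    have h1 := (ha _ hut).norm_solution_sub_le (hB _ hut) hμA hκ (hball (hxmem t ht (n + 1))) hz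
      (hxsol t ht n) hzs
    rw [sub_self, norm_zero, mul_zero] at h1
    exact sub_eq_zero.1 (norm_le_zero_iff.1 h1)
  · refine (hconv t ht n).trans ?_
    have h1 := ht.1
    gcongr
    linarith
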